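/- **Setting.** Let $\Bbbk$ be a commutative ring, $G$ a group and $\mathcal C$ a $G$-graded pivotal $\Bbbk$-linear monoidal category: every object $X$ has a dual $X^*$ with $\mathrm{ev}_X:X^*\otimes X\to\mathbb 1$, $\mathrm{coev}_X:\mathbb 1\to X\otimes X^*$, $\widetilde{\mathrm{ev}}_X:X\otimes X^*\to\mathbb 1$, $\widetilde{\mathrm{coev}}_X:\mathbb 1\to X^*\otimes X$ whose left and right dual functors coincide as monoidal functors; $\mathcal C$ has finite direct sums; and there are full subcategories $\mathcal C_\alpha$ ($\alpha\in G$), closed under finite direct sums, such that each object of $\mathcal C$ is a finite direct sum of objects of the $\mathcal C_\alpha$'s, $\mathcal C_\alpha\otimes\mathcal C_\beta\subset\mathcal C_{\alpha\beta}$, $\mathcal C_\alpha^*\subset\mathcal C_{\alpha^{-1}}$, $\mathbb 1\in\mathcal C_1$, and $\mathrm{Hom}(X,Y)=0$ for $X\in\mathcal C_\alpha$, $Y\in\mathcal C_\beta$, $\alpha\neq\beta$. Assume that $\mathcal C$ is *non-singular*: $d\otimes\mathrm{id}_X=\mathrm{id}_X\otimes d$ for all $d\in\mathrm{End}(\mathbb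 1)$ and all $X$, idempotents split, and for each $\alpha$ the class $\mathcal E_\alpha$ of objects $V\in\mathcal C_\alpha$ with invertible left dimension $d_V=\mathrm{ev}_V\,\widetilde{\mathrm{coev}}_V$ is non-empty. Assume also that $\mathcal C$ is *$G$-centralizable*: for all $\alpha\in G$ and $X\in\mathcal C$ the coend $Z_\alpha(X)=\int^{Y\in\mathcal C_\alpha}Y^*\otimes X\otimes Y$ exists in $\mathcal C$. Fix such coends, with universal dinatural transformations $\rho^\alpha_{X,Y}:Y^*\otimes X\otimes Y\to Z_\alpha(X)$, and put $$\partial^\alpha_{X,Y}=(\mathrm{id}_Y\otimes\rho^\alpha_{X,Y})(\mathrm{coev}_Y\otimes\mathrm{id}_{X\otimes Y}):X\otimes Y\to Y\otimes Z_\alpha(X)\qquad(Y\in\mathcal C_\alpha).$$ (Associativity and unit constraints are suppressed.) **Center and crossing.** The objects of $\mathcal Z_G(\mathcal C)$ are the pairs $(A,\sigma)$ with $A\in\mathcal C$ and $\sigma=\{\sigma_X:A\otimes X\to X\otimes A\}_{X\in\mathcal C_1}$ a natural family of isomorphisms with $\sigma_{X\otimes Y}=(\mathrm{id}_X\otimes\sigma_Y)(\sigma_X\otimes\mathrm{id}_Y)$;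 its morphisms are the morphisms of $\mathcal C$ commuting with the $\sigma$'s. For $V\in\mathcal E_\alpha$, the endomorphism $$\pi^V_{(A,\sigma)}=d_V^{-1}(\mathrm{ev}_V\otimes\mathrm{id}_{V^*\otimes A\otimes V})(\mathrm{id}_{V^*}\otimes\sigma_{V\otimes V^*}\otimes\mathrm{id}_V)(\mathrm{id}_{V^*\otimes A\otimes V}\otimes\widetilde{\mathrm{coev}}_V)$$ of $V^*\otimes A\otimes V$ is an idempotent; fix a splitting $p^V:V^*\otimes A\otimes V\to E^V$, $q^V:E^V\to V^*\otimes A\otimes V$, $q^Vp^V=\pi^V$, $p^Vq^V=\mathrm{id}$. Let $\varphi_V$ be the endofunctor of $\mathcal Z_G(\mathcal C)$ with $\varphi_V(A,\sigma)=(E^V,\gamma^V)$, where $$\gamma^V_X=d_V^{-1}(\mathrm{id}_X\otimes p^V)(\mathrm{ev}_V\otimes\mathrm{id}_{X\otimes V^*\otimes A\otimes V})(\mathrm{id}_{V^*}\otimes\sigma_{V\otimes X\otimes V^*}\otimes\mathrm{id}_V)(\mathrm{id}_{V^*\otimes A\otimes V\otimes X}\otimes\widetilde{\mathrm{coev}}_V)(q^V\otimes\mathrm{id}_X),$$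 and $\varphi_V(f)=p^V(\mathrm{id}_{V^*}\otimes f\otimes\mathrm{id}_V)q^V$. With the natural isomorphisms $$\delta^{U,V}=d_V^{-1}p^U(\mathrm{ev}_V\otimes\mathrm{id}_{U^*\otimes A\otimes U})(\mathrm{id}_{V^*}\otimes\sigma_{V\otimes U^*}\otimes\mathrm{id}_U)(\mathrm{id}_{V^*\otimes A\otimes V}\otimes\widetilde{\mathrm{coev}}_U)q^V:\varphi_V\to\varphi_U\qquad(U,V\in\mathcal E_\alpha),$$ the $\varphi_V$ form a projective system; let $\varphi_\alpha$ be a projective limit of it, with universal cone $\iota^\alpha_V:\varphi_\alpha\to\varphi_V$. The *enhanced $G$-braiding* is the family of morphisms $\tau_{(A,\sigma),Y}:A\otimes Y\to Y\otimes\varphi_\alpha(A,\sigma)$, for $(A,\sigma)\in\mathcal Z_G(\mathcal C)$ and $Y\in\mathcal C_\alpha$, determined by $$(\mathrm{id}_Y\otimes(\iota^\alpha_V)_{(A,\sigma)})\,\tau_{(A,\sigma),Y}=(\mathrm{id}_Y\otimes p^V)(\sigma_{Y\otimes V^*}\otimes\mathrm{id}_V)(\mathrm{id}_{A\otimes Y}\otimes\widetilde{\mathrm{coev}}_V)\qquad\text{for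 all }V\in\mathcal E_\alpha.$$ **Free objects.** Let $Z_2(\alpha,\beta)_X:Z_\alpha Z_\beta(X)\to Z_{\beta\alpha}(X)$ be the unique morphism such that $$\bigl(\mathrm{id}_{Y'}\otimes(\mathrm{id}_Y\otimes Z_2(\alpha,\beta)_X)\,\partial^\alpha_{Z_\beta(X),Y}\bigr)(\partial^\beta_{X,Y'}\otimes\mathrm{id}_Y)=\partial^{\beta\alpha}_{X,Y'\otimes Y}\qquad\text{for all }Y\in\mathcal C_\alpha,\ Y'\in\mathcal C_\beta.$$ The free object is $\mathcal F_\alpha(X)=(Z_\alpha(X),\sigma^\alpha_X)\in\mathcal Z_G(\mathcal C)$ with $\sigma^\alpha_{X,Y}=(\mathrm{id}_Y\otimes Z_2(1,\alpha)_X)\,\partial^1_{Z_\alpha(X),Y}$ for $Y\in\mathcal C_1$. Let $\omega^{\beta,\alpha}_X:\varphi_\beta\mathcal F_\alpha(X)\to\mathcal F_{\alpha\beta}(X)$ be the morphism of $\mathcal Z_G(\mathcal C)$ such that, for every $V\in\mathcal E_\beta$, $$\omega^{\beta,\alpha}_X=d_V^{-1}\,(\mathrm{ev}_V\otimes\mathrm{id}_{Z_{\alpha\beta}(X)})\bigl(\mathrm{id}_{V^*}\otimes(\mathrm{id}_V\otimes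 Z_2(\beta,\alpha)_X)\,\partial^\beta_{Z_\alpha(X),V}\bigr)\,q^V\,(\iota^\beta_V)_{\mathcal F_\alpha(X)}.$$ **Theorem 9.4.** Let $\alpha,\beta\in G$, $X\in\mathcal C$ and $Y\in\mathcal C_\beta$. Then $\omega^{\beta,\alpha}_X$ is an isomorphism and $$\tau_{\mathcal F_\alpha(X),Y}=\bigl(\mathrm{id}_Y\otimes(\omega^{\beta,\alpha}_X)^{-1}Z_2(\beta,\alpha)_X\bigr)\,\partial^\beta_{Z_\alpha(X),Y}.$$ **Fusion case.** Call an object $i$ simple if $\mathrm{End}(i)$ is a free $\Bbbk$-module of rank $1$. Suppose in addition that $\mathcal C$ is $G$-fusion: $\mathbb 1$ is simple, every object is a finite direct sum of simple objects, $\mathrm{Hom}(i,j)=0$ for non-isomorphic simple $i,j$, and each $\mathcal C_\delta$ contains at least one and, up to isomorphism, only finitely many simple objects. Let $I$ be a set of homogeneous simple objects such that every simple object is isomorphic to exactly one element of $I$, and let $I_\delta$ be the set of elements of $I$ lying in $\mathcal C_\delta$. Then: 1. for every $\delta\in G$, the morphisms $\rho^\delta_{X,i}:i^*\otimes X\otimes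 i\to Z_\delta(X)$, $i\in I_\delta$, are the inclusions of a direct sum decomposition $Z_\delta(X)=\bigoplus_{i\in I_\delta}i^*\otimes X\otimes i$; 2. for every $i\in I_\alpha$, the object $i\otimes Y$ is a finite direct sum of objects $j_{i,l}\in I_{\alpha\beta}$, with projections $p_{i,l}:i\otimes Y\to j_{i,l}$ and inclusions $q_{i,l}:j_{i,l}\to i\otimes Y$; 3. if $\pi_i:Z_\alpha(X)\to i^*\otimes X\otimes i$ $(i\in I_\alpha)$ are the projections of the decomposition in 1 for $\delta=\alpha$, and $(j_{i,l},p_{i,l},q_{i,l})_l$ are any decompositions as in 2, then $$(\mathrm{id}_Y\otimes\omega^{\beta,\alpha}_X)\,\tau_{\mathcal F_\alpha(X),Y}=\sum_{i\in I_\alpha}\sum_l\bigl(\mathrm{id}_Y\otimes\rho^{\alpha\beta}_{X,j_{i,l}}\bigr)\,\Theta_{i,l}\,(\pi_i\otimes\mathrm{id}_Y),$$ where $$\Theta_{i,l}=\bigl((\mathrm{ev}_i\otimes\mathrm{id}_{Y\otimes j_{i,l}^*})(\mathrm{id}_{i^*}\otimes q_{i,l}\otimes\mathrm{id}_{j_{i,l}^*})(\mathrm{id}_{i^*}\otimes\mathrm{coev}_{j_{i,l}})\bigr)\otimes\mathrm{id}_X\otimes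 p_{i,l}:\ i^*\otimes X\otimes i\otimes Y\to Y\otimes j_{i,l}^*\otimes X\otimes j_{i,l}.$$ -/

import Mathlib

open CategoryTheory MonoidalCategory Limits Opposite

universe w v u

namespace GCat

noncomputable section

section Pivotal

variable {C : Type u} [Category.{v} C] [MonoidalCategory C]

/-- The dual `f^* : Y^* ⟶ X^*` of `f : X ⟶ Y`, computed from pairings
`ev : Y^* ⊗ Y ⟶ 𝟙`, `coev : 𝟙 ⟶ X ⊗ X^*` (left duals). -/
def leftMate {X X' Y Y' : C} [ExactPairing X X'] [ExactPairing Y Y'] (f : X ⟶ Y) : Y' ⟶ X' :=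
  (ρ_ _).inv ≫ Y' ◁ η_ X X' ≫ Y' ◁ f ▷ X' ≫ (α_ _ _ _).inv ≫ ε_ Y Y' ▷ X' ≫ (λ_ _).hom

/-- The dual `f^* : Y^* ⟶ X^*` of `f : X ⟶ Y`, computed from pairings
`Y ⊗ Y^* ⟶ 𝟙`, `𝟙 ⟶ X^* ⊗ X` (right duals). -/
def rightMate {X X' Y Y' : C} [ExactPairing X' X] [ExactPairing Y' Y] (f : X ⟶ Y) : Y' ⟶ X' :=
  (λ_ _).inv ≫ η_ X' X ▷ Y' ≫ (X' ◁ f) ▷ Y' ≫ (α_ _ _ _).hom ≫ X' ◁ ε_ Y' Y ≫ (ρ_ _).hom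

variable (C) in
/-- A pivotal category: every object `X` has a dual object `X^*` which is at the same time a left
dual, through `ev`, `coev`, and a right dual, through `evt`, `coevt`, and the resulting left and
right dual functors `Cᵒᵖ ⥤ C` agree as monoidal functors, i.e. on morphisms and in their monoidal
constraints `X^* ⊗ Y^* ⟶ (Y ⊗ X)^*` and `𝟙 ⟶ 𝟙^*`.
In Mathlib, `ExactPairing X Y` consists of `η_ X Y : 𝟙 ⟶ X ⊗ Y` and `ε_ X Y : Y ⊗ X ⟶ 𝟙`
satisfying the two zigzag identities. -/
class PivotalCategory where
  dual : C → C
  leftPairing (X : C) : ExactPairing X (dual X)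
  rightPairing (X : C) : ExactPairing (dual X) X
  mate_eq {X Y : C} (f : X ⟶ Y) :
    (leftMate f : dual Y ⟶ dual X) = rightMate f
  tensor_eq (X Y : C) :
    (𝟙 _ ⊗≫ (dual X ⊗ dual Y) ◁ η_ (Y ⊗ X) (dual (Y ⊗ X)) ⊗≫
        dual X ◁ (ε_ Y (dual Y) ▷ (X ⊗ dual (Y ⊗ X))) ⊗≫
        ε_ X (dual X) ▷ dual (Y ⊗ X) ⊗≫ 𝟙 _ : dual X ⊗ dual Y ⟶ dual (Y ⊗ X)) =
      𝟙 _ ⊗≫ η_ (dual (Y ⊗ X)) (Y ⊗ X) ▷ (dual X ⊗ dual Y) ⊗≫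
        (dual (Y ⊗ X) ⊗ Y) ◁ (ε_ (dual X) X ▷ dual Y) ⊗≫
        dual (Y ⊗ X) ◁ ε_ (dual Y) Y ⊗≫ 𝟙 _
  unit_eq : η_ (𝟙_ C) (dual (𝟙_ C)) ≫ (λ_ _).hom = η_ (dual (𝟙_ C)) (𝟙_ C) ≫ (ρ_ _).hom

attribute [reducible, instance] PivotalCategory.leftPairing PivotalCategory.rightPairing

variable [PivotalCategory C]

/-- The dual object `X^*`. -/
abbrev dual (X : C) : C := PivotalCategory.dual X

/-- `ev_X : X^* ⊗ X ⟶ 𝟙`. -/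
abbrev ev (X : C) : dual X ⊗ X ⟶ 𝟙_ C := ε_ X (dual X)

/-- `coev_X : 𝟙 ⟶ X ⊗ X^*`. -/
abbrev coev (X : C) : 𝟙_ C ⟶ X ⊗ dual X := η_ X (dual X)

/-- The second evaluation `X ⊗ X^* ⟶ 𝟙`. -/
abbrev evt (X : C) : X ⊗ dual X ⟶ 𝟙_ C := ε_ (dual X) X

/-- The second coevaluation `𝟙 ⟶ X^* ⊗ X`. -/
abbrev coevt (X : C) : 𝟙_ C ⟶ dual X ⊗ X := η_ (dual X) X

/-- The dual morphism `f^* : Y^* ⟶ X^*`. -/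
abbrev dualMap {X Y : C} (f : X ⟶ Y) : dual Y ⟶ dual X := leftMate f

/-- The left dimension `dim_l(X) ∈ End(𝟙)`. -/
def dimL (X : C) : 𝟙_ C ⟶ 𝟙_ C := coevt X ≫ ev X

end Pivotal

section Scalars

variable {C : Type u} [Category.{v} C] [MonoidalCategory C]

/-- The product `d f` of `d ∈ End(𝟙)` with a morphism `f`. -/
def scal (d : 𝟙_ C ⟶ 𝟙_ C) {A B : C} (f : A ⟶ B) : A ⟶ B :=
  (λ_ A).inv ≫ d ▷ A ≫ (λ_ A).hom ≫ f

variable (C) in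
/-- A monoidal category is pure if `d ⊗ id_X = id_X ⊗ d` for all `d ∈ End(𝟙)`. -/
def IsPure : Prop :=
  ∀ (d : 𝟙_ C ⟶ 𝟙_ C) (X : C),
    (λ_ X).inv ≫ d ▷ X ≫ (λ_ X).hom = (ρ_ X).inv ≫ X ◁ d ≫ (ρ_ X).hom

theorem scal_comp (d : 𝟙_ C ⟶ 𝟙_ C) {X Y Z : C} (f : X ⟶ Y) (g : Y ⟶ Z) :
    scal d f ≫ g = scal d (f ≫ g) := by
  simp [scal]

theorem comp_scal (d : 𝟙_ C ⟶ 𝟙_ C) {X Y Z : C} (f : X ⟶ Y) (g : Y ⟶ Z) :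
    f ≫ scal d g = scal d (f ≫ g) := by
  simp only [scal]
  rw [leftUnitor_inv_naturality_assoc, whisker_exchange_assoc, leftUnitor_naturality_assoc]

theorem scal_scal (d e : 𝟙_ C ⟶ 𝟙_ C) {X Y : C} (f : X ⟶ Y) :
    scal d (scal e f) = scal (d ≫ e) f := by
  simp [scal]

theorem scal_comm (d e : 𝟙_ C ⟶ 𝟙_ C) {X Y : C} (f : X ⟶ Y) :
    scal d (scal e f) = scal e (scal d f) := by
  calc scal d (scal e f) = scal d (scal e (𝟙 X) ≫ f) := by rw [scal_comp, Category.id_comp]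
    _ = _ := by rw [← comp_scal, scal_comp, Category.id_comp]

theorem scal_one {X Y : C} (f : X ⟶ Y) : scal (𝟙 (𝟙_ C)) f = f := by
  simp [scal]

theorem scal_whiskerRight (d : 𝟙_ C ⟶ 𝟙_ C) {X Y : C} (f : X ⟶ Y) (Z : C) :
    scal d f ▷ Z = scal d (f ▷ Z) := by
  simp only [scal]; monoidal

theorem IsPure.whiskerLeft_scal (h : IsPure C) (d : 𝟙_ C ⟶ 𝟙_ C) {X Y : C} (f : X ⟶ Y) (Z : C) :
    Z ◁ scal d f = scal d (Z ◁ f) := by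
  have h2 : (λ_ (Z ⊗ X)).inv ≫ d ▷ (Z ⊗ X) ≫ (λ_ (Z ⊗ X)).hom =
      ((λ_ Z).inv ≫ d ▷ Z ≫ (λ_ Z).hom) ▷ X := by monoidal
  calc Z ◁ scal d f = ((ρ_ Z).inv ≫ Z ◁ d ≫ (ρ_ Z).hom) ▷ X ≫ Z ◁ f := by
        simp only [scal]; monoidal
    _ = _ := by rw [← h d Z, ← h2]; simp [scal]

theorem scal_monoidalComp (d : 𝟙_ C ⟶ 𝟙_ C) {X Y Z W : C} [MonoidalCoherence Y Z] (f : X ⟶ Y)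
    (g : Z ⟶ W) : scal d f ⊗≫ g = scal d (f ⊗≫ g) := by
  simp only [monoidalComp, scal_comp]

theorem monoidalComp_scal (d : 𝟙_ C ⟶ 𝟙_ C) {X Y Z W : C} [MonoidalCoherence Y Z] (f : X ⟶ Y)
    (g : Z ⟶ W) : f ⊗≫ scal d g = scal d (f ⊗≫ g) := by
  simp only [monoidalComp, comp_scal]

theorem whiskerRight_eq_scal (d : 𝟙_ C ⟶ 𝟙_ C) (X : C) :
    d ▷ X = scal d (𝟙 (𝟙_ C ⊗ X)) := by
  rw [← id_whiskerRight, ← scal_whiskerRight]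
  congr 1
  simp [scal, unitors_equal, unitors_inv_equal]

theorem existsUnique_lift {I : Type*} {B E : C} (X : C) (F : I → C) (leg : ∀ V, E ⟶ F V)
    (hleg : ∀ V, IsIso (leg V)) (d : ∀ V U, F V ⟶ F U) (hd : ∀ V U, leg V ≫ d V U = leg U)
    (g : ∀ V, B ⟶ X ⊗ F V) (hg : ∀ V U, g V ≫ X ◁ d V U = g U) (hI : Nonempty I) :
    ∃! t : B ⟶ X ⊗ E, ∀ V, t ≫ X ◁ leg V = g V := by
  obtain ⟨V⟩ := hI
  refine ⟨g V ≫ X ◁ inv (leg V), fun U => ?_, fun t ht => ?_⟩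
  · rw [← hd V U, Category.assoc, ← MonoidalCategory.whiskerLeft_comp, IsIso.inv_hom_id_assoc,
      hg]
  · rw [← ht V, Category.assoc, ← MonoidalCategory.whiskerLeft_comp, IsIso.hom_inv_id,
      MonoidalCategory.whiskerLeft_id, Category.comp_id]

end Scalars

end

end GCat

namespace GCat

noncomputable section

section Grading

variable (G : Type w) [Group G] (C : Type u) [Category.{v} C] [MonoidalCategory C]
  [PivotalCategory C] [Preadditive C] [HasFiniteBiproducts C]

/-- A `G`-grading of `C`: full subcategories `C_α` (for `α ∈ G`), each stable under finite direct
sums (up to isomorphism), such that every object is a finite direct sum of homogeneous ones,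
`C_α ⊗ C_β ⊆ C_{αβ}`, `𝟙 ∈ C_1`, and there are no non-zero morphisms between objects of
distinct degrees. In particular an object of two distinct degrees is a zero object. -/
structure GGrading where
  deg : G → ObjectProperty C
  sum_mem (α : G) (n : ℕ) (f : Fin n → C) (hf : ∀ i, deg α (f i)) :
    ∃ Z : C, deg α Z ∧ Nonempty (Z ≅ ⨁ f)
  exists_decomposition (X : C) : ∃ (n : ℕ) (a : Fin n → G) (f : Fin n → C),
    (∀ i, deg (a i) (f i)) ∧ Nonempty (X ≅ ⨁ f)
  tensor_mem {α β : G} {X Y : C} : deg α X → deg β Y → deg (α * β) (X ⊗ Y)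
  hom_eq_zero {α β : G} {X Y : C} :
    deg α X → deg β Y → α ≠ β → ∀ f : X ⟶ Y, f = 0
  unit_mem : deg 1 (𝟙_ C)

/-- A `G`-grading of a pivotal category, in which the chosen dual of an object of `C_α` lies in
`C_{α⁻¹}`. -/
structure PivotalGrading extends GGrading G C where
  dual_mem {α : G} {X : C} : deg α X → deg α⁻¹ (dual X)

end Grading

section Center

variable {C : Type u} [Category.{v} C] [MonoidalCategory C]

/-- An object `(A, σ)` of the center of `C` relative to the full subcategory of `C` given by `P`:
an object `A` of `C` together with a half-braiding `σ_X : A ⊗ X ≅ X ⊗ A`, where `X` satisfies `P`,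
which is natural and multiplicative. -/
structure RelCenter (P : ObjectProperty C) where
  obj : C
  braid (X : C) (hX : P X) : obj ⊗ X ≅ X ⊗ obj
  natural {X Y : C} (hX : P X) (hY : P Y) (f : X ⟶ Y) :
    obj ◁ f ≫ (braid Y hY).hom = (braid X hX).hom ≫ f ▷ obj
  tensor {X Y : C} (hX : P X) (hY : P Y) (hXY : P (X ⊗ Y)) :
    (braid (X ⊗ Y) hXY).hom = (α_ obj X Y).inv ≫ (braid X hX).hom ▷ Y ≫ (α_ X obj Y).hom ≫
      X ◁ (braid Y hY).hom ≫ (α_ X Y obj).inv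

namespace RelCenter

variable {P : ObjectProperty C}

/-- Morphisms in the relative center: morphisms of `C` commuting with the half-braidings. -/
@[ext]
structure Hom (A B : RelCenter P) where
  hom : A.obj ⟶ B.obj
  comm (X : C) (hX : P X) : hom ▷ X ≫ (B.braid X hX).hom = (A.braid X hX).hom ≫ X ◁ hom

instance : Category (RelCenter P) where
  Hom := Hom
  id A := ⟨𝟙 _, by simp⟩
  comp f g := ⟨f.hom ≫ g.hom, fun X hX => by
    simp [g.comm, reassoc_of% (f.comm X hX)]⟩

@[ext]
theorem hom_ext {A B : RelCenter P} {f g : A ⟶ B} (h : f.hom = g.hom) : f = g :=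
  Hom.ext h

@[simp] theorem id_hom (A : RelCenter P) : Hom.hom (𝟙 A) = 𝟙 A.obj := rfl

@[simp] theorem comp_hom {A B D : RelCenter P} (f : A ⟶ B) (g : B ⟶ D) :
    (f ≫ g).hom = f.hom ≫ g.hom := rfl

variable (P) in
/-- The forgetful functor. -/
def forget : RelCenter P ⥤ C where
  obj A := A.obj
  map f := f.hom

instance {A B : RelCenter P} (f : A ⟶ B) [IsIso f] : IsIso f.hom :=
  inferInstanceAs (IsIso ((forget P).map f))

theorem isIso_of_hom {A B : RelCenter P} (f : A ⟶ B) (h : IsIso f.hom) : IsIso f := by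
  refine ⟨⟨⟨inv f.hom, fun X hX => ?_⟩, ?_, ?_⟩⟩
  · rw [← cancel_epi (f.hom ▷ X), reassoc_of% (f.comm X hX)]
    simp [← comp_whiskerRight_assoc, ← MonoidalCategory.whiskerLeft_comp]
  · ext; exact IsIso.hom_inv_id f.hom
  · ext; exact IsIso.inv_hom_id f.hom

/-- The half-braiding with the unit object is the canonical one. -/
theorem braid_unit (A : RelCenter P) (h : P (𝟙_ C)) (h2 : P (𝟙_ C ⊗ 𝟙_ C)) :
    (A.braid (𝟙_ C) h).hom = (ρ_ A.obj).hom ≫ (λ_ A.obj).inv := by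
  have key : (A.braid (𝟙_ C) h).hom ▷ 𝟙_ C ≫ (α_ _ _ _).hom ≫ 𝟙_ C ◁ (A.braid (𝟙_ C) h).hom =
      (A.braid (𝟙_ C) h).hom ▷ 𝟙_ C ≫ (α_ _ _ _).hom ≫
        𝟙_ C ◁ ((ρ_ A.obj).hom ≫ (λ_ A.obj).inv) := by
    have h1 := A.tensor h h h2
    have h3 := A.natural h2 h (λ_ (𝟙_ C)).hom
    rw [h1] at h3
    have h4 : (A.braid (𝟙_ C) h).hom ▷ 𝟙_ C ≫ (α_ _ _ _).hom ≫ 𝟙_ C ◁ (A.braid (𝟙_ C) h).hom =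
      (α_ _ _ _).hom ≫ (A.obj ◁ (λ_ (𝟙_ C)).hom ≫ (A.braid (𝟙_ C) h).hom) ≫ (λ_ _).inv ▷ _ ≫
        (α_ _ _ _).hom := by
      rw [h3]; monoidal
    rw [h4]
    monoidal
  have h5 := (cancel_epi _).1 ((cancel_epi _).1 key)
  exact (whiskerLeft_iff _ _).1 h5

section Mk

variable [PivotalCategory C]

/-- A natural multiplicative family of morphisms `A ⊗ X ⟶ X ⊗ A` which is trivial for `X = 𝟙` is
a half-braiding: it is invertible if `P` is stable under duality. -/
def mk' (A : C) (s : ∀ X : C, P X → (A ⊗ X ⟶ X ⊗ A))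
    (h1 : P (𝟙_ C)) (hdual : ∀ X, P X → P (dual X)) (ht : ∀ X Y, P X → P Y → P (X ⊗ Y))
    (natural : ∀ {X Y : C} (hX : P X) (hY : P Y) (f : X ⟶ Y), A ◁ f ≫ s Y hY = s X hX ≫ f ▷ A)
    (tensor : ∀ {X Y : C} (hX : P X) (hY : P Y) (hXY : P (X ⊗ Y)),
      s (X ⊗ Y) hXY = (α_ A X Y).inv ≫ s X hX ▷ Y ≫ (α_ X A Y).hom ≫
        X ◁ s Y hY ≫ (α_ X Y A).inv)
    (unit : s (𝟙_ C) h1 = (ρ_ A).hom ≫ (λ_ A).inv) : RelCenter P where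
  obj := A
  braid X hX :=
    { hom := s X hX
      inv := 𝟙 _ ⊗≫ (X ⊗ A) ◁ coevt X ⊗≫ X ◁ s (dual X) (hdual X hX) ▷ X ⊗≫
        evt X ▷ (A ⊗ X) ⊗≫ 𝟙 _
      hom_inv_id := by
        have t := tensor hX (hdual X hX) (ht _ _ hX (hdual X hX))
        have n := natural (ht _ _ hX (hdual X hX)) h1 (evt X)
        rw [unit, t] at n
        calc _ = 𝟙 _ ⊗≫ (s X hX ▷ (𝟙_ C) ≫ (X ⊗ A) ◁ coevt X) ⊗≫
              X ◁ s (dual X) (hdual X hX) ▷ X ⊗≫ evt X ▷ (A ⊗ X) ⊗≫ 𝟙 _ := by monoidal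
          _ = 𝟙 _ ⊗≫ (A ⊗ X) ◁ coevt X ⊗≫ (((α_ A X (dual X)).inv ≫ s X hX ▷ (dual X) ≫
                (α_ X A (dual X)).hom ≫ X ◁ s (dual X) (hdual X hX) ≫
                  (α_ X (dual X) A).inv) ≫ evt X ▷ A) ▷ X ⊗≫ 𝟙 _ := by
              rw [← whisker_exchange]; monoidal
          _ = 𝟙 _ ⊗≫ A ◁ (X ◁ coevt X ⊗≫ evt X ▷ X) ⊗≫ 𝟙 _ := by
              rw [← n]; monoidal
          _ = _ := by
              rw [ExactPairing.coevaluation_evaluation'']; monoidal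
      inv_hom_id := by
        have t := tensor (hdual X hX) hX (ht _ _ (hdual X hX) hX)
        have n := natural h1 (ht _ _ (hdual X hX) hX) (coevt X)
        rw [unit, t] at n
        calc _ = 𝟙 _ ⊗≫ (X ⊗ A) ◁ coevt X ⊗≫ X ◁ s (dual X) (hdual X hX) ▷ X ⊗≫
              (evt X ▷ (A ⊗ X) ≫ 𝟙_ C ◁ s X hX) ⊗≫ 𝟙 _ := by monoidal
          _ = 𝟙 _ ⊗≫ X ◁ (A ◁ coevt X ≫ ((α_ A (dual X) X).inv ≫ s (dual X) (hdual X hX) ▷ X ≫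
                (α_ (dual X) A X).hom ≫ (dual X) ◁ s X hX ≫
                  (α_ (dual X) X A).inv)) ⊗≫ evt X ▷ (X ⊗ A) ⊗≫ 𝟙 _ := by
              rw [← whisker_exchange]; monoidal
          _ = 𝟙 _ ⊗≫ (X ◁ coevt X ⊗≫ evt X ▷ X) ▷ A ⊗≫ 𝟙 _ := by
              rw [n]; monoidal
          _ = _ := by
              rw [ExactPairing.coevaluation_evaluation'']; monoidal }
  natural := natural
  tensor := tensor

end Mk

end RelCenter

end Center

end

end GCat

namespace GCat

noncomputable section

section Splitting

variable {C : Type u} [Category.{v} C]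

/-- A splitting of an endomorphism `e`. -/
structure Splitting {X : C} (e : X ⟶ X) where
  obj : C
  p : X ⟶ obj
  q : obj ⟶ X
  p_q : p ≫ q = e
  q_p : q ≫ p = 𝟙 obj

theorem Splitting.q_e_p {X : C} {e : X ⟶ X} (s : Splitting e) : s.q ≫ e ≫ s.p = 𝟙 _ :=
  calc s.q ≫ e ≫ s.p = s.q ≫ (s.p ≫ s.q) ≫ s.p := by rw [s.p_q]
    _ = 𝟙 _ := by simp [s.q_p]

end Splitting

section Crossing

variable {G : Type w} [Group G] {C : Type u} [Category.{v} C] [MonoidalCategory C]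
  [PivotalCategory C] [Preadditive C] [HasFiniteBiproducts C]

/-- The `G`-center of `C`, i.e. the center of `C` relative to `C_1`. -/
abbrev GCenter (D : PivotalGrading G C) := RelCenter (D.deg 1)

/-- The class `E_α` of objects of `C_α` with invertible left dimension. -/
structure InvObj (D : PivotalGrading G C) (α : G) where
  obj : C
  mem : D.deg α obj
  isIso_dim : IsIso (dimL obj)

/-- A non-singular grading: `C` is pure, idempotents split, and every `C_α` contains an object with
invertible left dimension. -/
structure NonSingular (D : PivotalGrading G C) : Prop where
  pure : IsPure C
  split : IsIdempotentComplete C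
  exists_inv (α : G) : Nonempty (InvObj D α)

theorem PivotalGrading.mem_cast (D : PivotalGrading G C) {α β : G} {X : C} (h : D.deg α X)
    (e : α = β) : D.deg β X := e ▸ h

theorem PivotalGrading.mem_tensor_dual (D : PivotalGrading G C) {α : G} {X Y : C}
    (hX : D.deg α X) (hY : D.deg α Y) : D.deg 1 (X ⊗ dual Y) :=
  D.mem_cast (D.tensor_mem hX (D.dual_mem hY)) (mul_inv_cancel α)

theorem PivotalGrading.mem_tensor_one (D : PivotalGrading G C) {α : G} {X Y : C}
    (hX : D.deg α X) (hY : D.deg 1 Y) : D.deg α (X ⊗ Y) :=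
  D.mem_cast (D.tensor_mem hX hY) (mul_one α)

theorem PivotalGrading.mem_one_tensor (D : PivotalGrading G C) {α : G} {X Y : C}
    (hX : D.deg 1 X) (hY : D.deg α Y) : D.deg α (X ⊗ Y) :=
  D.mem_cast (D.tensor_mem hX hY) (one_mul α)

theorem PivotalGrading.dual_mem_one (D : PivotalGrading G C) {X : C}
    (hX : D.deg 1 X) : D.deg 1 (dual X) :=
  D.mem_cast (D.dual_mem hX) inv_one

variable {D : PivotalGrading G C}

/-- The morphism `(σ_{W ⊗ U^*} ⊗ U) (A ⊗ W ⊗ coevt_U)`, where `W ⊗ U^*` has degree `1`. -/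
def push (A : GCenter D) (W U : C) (h : D.deg 1 (W ⊗ dual U)) :
    A.obj ⊗ W ⟶ W ⊗ (dual U ⊗ (A.obj ⊗ U)) :=
  𝟙 _ ⊗≫ (A.obj ⊗ W) ◁ coevt U ⊗≫ (A.braid (W ⊗ dual U) h).hom ▷ U ⊗≫ 𝟙 _

theorem push_natural (A : GCenter D) {W W' : C} (U : C) (h : D.deg 1 (W ⊗ dual U))
    (h' : D.deg 1 (W' ⊗ dual U)) (f : W ⟶ W') :
    A.obj ◁ f ≫ push A W' U h' = push A W U h ≫ f ▷ _ := by
  have n := A.natural h h' (f ▷ dual U)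
  calc _ = 𝟙 _ ⊗≫ ((A.obj ◁ f) ▷ 𝟙_ C ≫ (A.obj ⊗ W') ◁ coevt U) ⊗≫
        (A.braid (W' ⊗ dual U) h').hom ▷ U ⊗≫ 𝟙 _ := by unfold push; monoidal
    _ = 𝟙 _ ⊗≫ (A.obj ⊗ W) ◁ coevt U ⊗≫ (A.obj ◁ (f ▷ dual U) ≫
        (A.braid (W' ⊗ dual U) h').hom) ▷ U ⊗≫ 𝟙 _ := by
      rw [← whisker_exchange]; monoidal
    _ = _ := by rw [n]; unfold push; monoidal

theorem push_natural_left {A B : GCenter D} (f : A ⟶ B) (W U : C) (h : D.deg 1 (W ⊗ dual U)) :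
    f.hom ▷ W ≫ push B W U h = push A W U h ≫ W ◁ (dual U ◁ (f.hom ▷ U)) := by
  have n := f.comm _ h
  calc _ = 𝟙 _ ⊗≫ ((f.hom ▷ W) ▷ 𝟙_ C ≫ (B.obj ⊗ W) ◁ coevt U) ⊗≫
        (B.braid (W ⊗ dual U) h).hom ▷ U ⊗≫ 𝟙 _ := by unfold push; monoidal
    _ = 𝟙 _ ⊗≫ (A.obj ⊗ W) ◁ coevt U ⊗≫ (f.hom ▷ (W ⊗ dual U) ≫
        (B.braid (W ⊗ dual U) h).hom) ▷ U ⊗≫ 𝟙 _ := by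
      rw [← whisker_exchange]; monoidal
    _ = _ := by rw [n]; unfold push; monoidal

/-- The morphism `V^* ⊗ A ⊗ V ⊗ X ⟶ X ⊗ U^* ⊗ A ⊗ U` obtained from `push A (V ⊗ X) U` by
evaluating `V`. -/
def pass (A : GCenter D) (V X U : C) (h : D.deg 1 ((V ⊗ X) ⊗ dual U)) :
    (dual V ⊗ (A.obj ⊗ V)) ⊗ X ⟶ X ⊗ (dual U ⊗ (A.obj ⊗ U)) :=
  𝟙 _ ⊗≫ dual V ◁ push A (V ⊗ X) U h ⊗≫ ev V ▷ (X ⊗ (dual U ⊗ (A.obj ⊗ U))) ⊗≫ 𝟙 _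

/-- The morphism `V^* ⊗ A ⊗ V ⟶ U^* ⊗ A ⊗ U` obtained from `push A V U` by evaluating `V`. -/
def pass₀ (A : GCenter D) (V U : C) (h : D.deg 1 (V ⊗ dual U)) :
    dual V ⊗ (A.obj ⊗ V) ⟶ dual U ⊗ (A.obj ⊗ U) :=
  𝟙 _ ⊗≫ dual V ◁ push A V U h ⊗≫ ev V ▷ (dual U ⊗ (A.obj ⊗ U)) ⊗≫ 𝟙 _

theorem pass_natural_right (A : GCenter D) (V : C) {X X' : C} (U : C)
    (h : D.deg 1 ((V ⊗ X) ⊗ dual U)) (h' : D.deg 1 ((V ⊗ X') ⊗ dual U)) (f : X ⟶ X') :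
    (dual V ⊗ (A.obj ⊗ V)) ◁ f ≫ pass A V X' U h' = pass A V X U h ≫ f ▷ _ := by
  have n := push_natural A U h h' (V ◁ f)
  calc _ = 𝟙 _ ⊗≫ dual V ◁ (A.obj ◁ (V ◁ f) ≫ push A (V ⊗ X') U h') ⊗≫
        ev V ▷ (X' ⊗ (dual U ⊗ (A.obj ⊗ U))) ⊗≫ 𝟙 _ := by unfold pass; monoidal
    _ = 𝟙 _ ⊗≫ dual V ◁ push A (V ⊗ X) U h ⊗≫ ((dual V ⊗ V) ◁ (f ▷ (dual U ⊗ (A.obj ⊗ U))) ≫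
        ev V ▷ (X' ⊗ (dual U ⊗ (A.obj ⊗ U)))) ⊗≫ 𝟙 _ := by rw [n]; monoidal
    _ = _ := by rw [whisker_exchange]; unfold pass; monoidal

theorem pass_natural_left {A B : GCenter D} (f : A ⟶ B) (V X U : C)
    (h : D.deg 1 ((V ⊗ X) ⊗ dual U)) :
    (dual V ◁ (f.hom ▷ V)) ▷ X ≫ pass B V X U h =
      pass A V X U h ≫ X ◁ (dual U ◁ (f.hom ▷ U)) := by
  have n := push_natural_left f (V ⊗ X) U h
  calc _ = 𝟙 _ ⊗≫ dual V ◁ (f.hom ▷ (V ⊗ X) ≫ push B (V ⊗ X) U h) ⊗≫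
        ev V ▷ (X ⊗ (dual U ⊗ (B.obj ⊗ U))) ⊗≫ 𝟙 _ := by unfold pass; monoidal
    _ = 𝟙 _ ⊗≫ dual V ◁ push A (V ⊗ X) U h ⊗≫
        ((dual V ⊗ V) ◁ (X ◁ (dual U ◁ (f.hom ▷ U))) ≫
        ev V ▷ (X ⊗ (dual U ⊗ (B.obj ⊗ U)))) ⊗≫ 𝟙 _ := by rw [n]; monoidal
    _ = _ := by rw [whisker_exchange]; unfold pass; monoidal

theorem pass_unit (A : GCenter D) (V U : C) (h : D.deg 1 ((V ⊗ 𝟙_ C) ⊗ dual U))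
    (h0 : D.deg 1 (V ⊗ dual U)) :
    pass A V (𝟙_ C) U h = (ρ_ _).hom ≫ pass₀ A V U h0 ≫ (λ_ _).inv := by
  have n := push_natural A U h h0 (ρ_ V).hom
  have n' : push A (V ⊗ 𝟙_ C) U h = A.obj ◁ (ρ_ V).hom ≫ push A V U h0 ≫ (ρ_ V).inv ▷ _ := by
    rw [reassoc_of% n]; monoidal
  unfold pass; rw [n']; unfold pass₀; monoidal

/-- The basic relation between `push` and `pass`. -/
theorem push_pass (hp : IsPure C) (A : GCenter D) (W V X U : C) (h : D.deg 1 (W ⊗ dual V))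
    (h' : D.deg 1 ((V ⊗ X) ⊗ dual U)) (h'' : D.deg 1 ((W ⊗ X) ⊗ dual U)) :
    push A W V h ▷ X ≫ (α_ _ _ _).hom ≫ W ◁ pass A V X U h' =
      scal (dimL V) ((α_ _ _ _).hom ≫ push A (W ⊗ X) U h'' ≫ (α_ _ _ _).hom) := by
  have hm : D.deg 1 ((W ⊗ dual V) ⊗ ((V ⊗ X) ⊗ dual U)) := D.mem_tensor_one h h'
  have t := A.tensor h h' hm
  let f : (W ⊗ dual V) ⊗ ((V ⊗ X) ⊗ dual U) ⟶ (W ⊗ X) ⊗ dual U :=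
    𝟙 _ ⊗≫ W ◁ (ev V ▷ (X ⊗ dual U)) ⊗≫ 𝟙 _
  have n := A.natural hm h'' f
  calc _ = 𝟙 _ ⊗≫ (A.obj ⊗ W) ◁ coevt V ▷ X ⊗≫
      ((A.braid _ h).hom ▷ (V ⊗ X ⊗ 𝟙_ C) ≫
        ((W ⊗ dual V) ⊗ A.obj) ◁ (V ◁ (X ◁ coevt U))) ⊗≫
        (W ⊗ dual V) ◁ (A.braid _ h').hom ▷ U ⊗≫
        W ◁ (ev V ▷ (X ⊗ (dual U ⊗ (A.obj ⊗ U)))) ⊗≫ 𝟙 _ := by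
        unfold pass push; monoidal
    _ = 𝟙 _ ⊗≫ A.obj ◁ (W ◁ coevt V ▷ X) ⊗≫ (A.obj ⊗ W ⊗ dual V ⊗ V ⊗ X) ◁ coevt U ⊗≫
        (((α_ _ _ _).inv ≫ (A.braid _ h).hom ▷ ((V ⊗ X) ⊗ dual U) ≫ (α_ _ _ _).hom ≫
        (W ⊗ dual V) ◁ (A.braid _ h').hom ≫ (α_ _ _ _).inv) ≫ f ▷ A.obj) ▷ U ⊗≫ 𝟙 _ := by
        rw [← whisker_exchange]; simp only [f]; monoidal
    _ = 𝟙 _ ⊗≫ A.obj ◁ (W ◁ coevt V ▷ X) ⊗≫ ((A.obj ⊗ W) ◁ ((dual V ⊗ V) ◁ (X ◁ coevt U)) ≫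
          (A.obj ⊗ W) ◁ (ev V ▷ (X ⊗ dual U ⊗ U))) ⊗≫ 
        ((A.braid _ h'').hom) ▷ U ⊗≫ 𝟙 _ := by
        rw [← t, ← n]; simp only [f]; monoidal
    _ = 𝟙 _ ⊗≫ (A.obj ⊗ W) ◁ (dimL V ▷ X) ⊗≫ (A.obj ⊗ W ⊗ X) ◁ coevt U ⊗≫
        ((A.braid _ h'').hom) ▷ U ⊗≫ 𝟙 _ := by
        rw [← MonoidalCategory.whiskerLeft_comp, whisker_exchange]; simp only [dimL]; monoidal
    _ = _ := by
        rw [whiskerRight_eq_scal]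
        simp only [hp.whiskerLeft_scal, scal_monoidalComp, monoidalComp_scal]
        congr 1
        unfold push; monoidal

theorem pass_pass (hp : IsPure C) (A : GCenter D) (W V X U Y : C)
    (h : D.deg 1 ((W ⊗ X) ⊗ dual V)) (h' : D.deg 1 ((V ⊗ Y) ⊗ dual U))
    (h'' : D.deg 1 ((W ⊗ (X ⊗ Y)) ⊗ dual U)) (h3 : D.deg 1 (((W ⊗ X) ⊗ Y) ⊗ dual U)) :
    pass A W X V h ▷ Y ≫ (α_ _ _ _).hom ≫ X ◁ pass A V Y U h' =
      scal (dimL V) ((α_ _ _ _).hom ≫ pass A W (X ⊗ Y) U h'' ≫ (α_ _ _ _).hom) := by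
  have m := push_pass hp A (W ⊗ X) V Y U h h' h3
  have n := push_natural A U h3 h'' (α_ W X Y).hom
  calc _ = 𝟙 _ ⊗≫ dual W ◁ push A (W ⊗ X) V h ▷ Y ⊗≫
        (ev W ▷ (X ⊗ ((dual V ⊗ (A.obj ⊗ V)) ⊗ Y)) ≫ 𝟙_ C ◁ (X ◁ pass A V Y U h')) ⊗≫ 𝟙 _ := by
        conv_lhs => arg 1; unfold pass
        monoidal
    _ = 𝟙 _ ⊗≫ dual W ◁ (push A (W ⊗ X) V h ▷ Y ≫ (α_ _ _ _).hom ≫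
          (W ⊗ X) ◁ pass A V Y U h') ⊗≫
        (ev W ▷ (X ⊗ (Y ⊗ (dual U ⊗ (A.obj ⊗ U))))) ⊗≫ 𝟙 _ := by
        rw [← whisker_exchange]; monoidal
    _ = scal (dimL V) (𝟙 _ ⊗≫ dual W ◁ push A ((W ⊗ X) ⊗ Y) U h3 ⊗≫
        (ev W ▷ (X ⊗ (Y ⊗ (dual U ⊗ (A.obj ⊗ U))))) ⊗≫ 𝟙 _) := by
        rw [m]
        simp only [hp.whiskerLeft_scal, scal_monoidalComp, monoidalComp_scal]
        congr 1
        monoidal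
    _ = _ := by
        congr 1
        have n' : push A ((W ⊗ X) ⊗ Y) U h3 =
            A.obj ◁ (α_ W X Y).hom ≫ push A (W ⊗ (X ⊗ Y)) U h'' ≫ (α_ W X Y).inv ▷ _ := by
          rw [reassoc_of% n]; monoidal
        rw [n']; unfold pass; monoidal

/-- The inverse `d_V⁻¹` of the left dimension of `V`. -/
def InvObj.invDim {α : G} (V : InvObj D α) : 𝟙_ C ⟶ 𝟙_ C :=
  have := V.isIso_dim
  inv (dimL V.obj)

theorem InvObj.invDim_dim {α : G} (V : InvObj D α) : V.invDim ≫ dimL V.obj = 𝟙 _ := by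
  have := V.isIso_dim
  simp [InvObj.invDim]

theorem InvObj.dim_invDim {α : G} (V : InvObj D α) : dimL V.obj ≫ V.invDim = 𝟙 _ := by
  have := V.isIso_dim
  simp [InvObj.invDim]

/-- The idempotent `π^V_{(A,σ)} = d_V⁻¹ (ev_V ⊗ id) (V^* ⊗ σ_{V ⊗ V^*} ⊗ V) (id ⊗ coevt_V)` of
`V^* ⊗ A ⊗ V`. -/
def piV {α : G} (V : InvObj D α) (A : GCenter D) :
    dual V.obj ⊗ (A.obj ⊗ V.obj) ⟶ dual V.obj ⊗ (A.obj ⊗ V.obj) :=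
  scal V.invDim (pass₀ A V.obj V.obj (D.mem_tensor_dual V.mem V.mem))

theorem pi_natural {α : G} (V : InvObj D α) {A B : GCenter D} (f : A ⟶ B) :
    piV V A ≫ dual V.obj ◁ (f.hom ▷ V.obj) = dual V.obj ◁ (f.hom ▷ V.obj) ≫ piV V B := by
  have n := pass_natural_left f V.obj (𝟙_ C) V.obj
    (D.mem_tensor_dual (D.mem_tensor_one V.mem D.unit_mem) V.mem)
  rw [pass_unit _ _ _ _ (D.mem_tensor_dual V.mem V.mem),
    pass_unit _ _ _ _ (D.mem_tensor_dual V.mem V.mem)] at n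
  simp only [piV, comp_scal, scal_comp]
  congr 1
  have e : dual V.obj ◁ (f.hom ▷ V.obj) ≫
    pass₀ B V.obj V.obj (D.mem_tensor_dual V.mem V.mem) = (ρ_ _).inv ≫
      ((dual V.obj ◁ (f.hom ▷ V.obj)) ▷ 𝟙_ C ≫ (ρ_ _).hom ≫
      pass₀ B V.obj V.obj (D.mem_tensor_dual V.mem V.mem) ≫ (λ_ _).inv) ≫ (λ_ _).hom := by
    monoidal
  rw [e, n]; monoidal

/-- A choice of a splitting `(E^V_A, p^V_A, q^V_A)` of each of the idempotents `π^V_A`. -/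
abbrev Splittings (D : PivotalGrading G C) :=
  ∀ (α : G) (V : InvObj D α) (A : GCenter D), Splitting (piV V A)

variable (S : Splittings D)

theorem mem_mid {α : G} {V X U : C} (hV : D.deg α V) (hX : D.deg 1 X) (hU : D.deg α U) :
    D.deg 1 ((V ⊗ X) ⊗ dual U) :=
  D.mem_tensor_dual (D.mem_tensor_one hV hX) hU

/-- The morphism `E^V ⊗ X ⟶ X ⊗ E^U` induced by `pass`. -/
def mid {α : G} (V U : InvObj D α) (A : GCenter D) (X : C) (hX : D.deg 1 X) :
    (S α V A).obj ⊗ X ⟶ X ⊗ (S α U A).obj :=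
  (S α V A).q ▷ X ≫ pass A V.obj X U.obj (mem_mid V.mem hX U.mem) ≫ X ◁ (S α U A).p

theorem pi_pass (hp : IsPure C) {α : G} (V U : InvObj D α) (A : GCenter D) (X : C)
    (hX : D.deg 1 X) :
    piV V A ▷ X ≫ pass A V.obj X U.obj (mem_mid V.mem hX U.mem) =
      pass A V.obj X U.obj (mem_mid V.mem hX U.mem) := by
  have h1 := mem_mid V.mem D.unit_mem V.mem
  have h0 := D.mem_tensor_dual V.mem V.mem
  have m := pass_pass hp A V.obj V.obj (𝟙_ C) U.obj X h1 (mem_mid V.mem hX U.mem)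
    (mem_mid V.mem (D.mem_tensor_one D.unit_mem hX) U.mem)
    (D.mem_tensor_dual (D.mem_tensor_one (D.mem_tensor_one V.mem D.unit_mem) hX) U.mem)
  have n := pass_natural_right A V.obj U.obj
    (mem_mid V.mem (D.mem_tensor_one D.unit_mem hX) U.mem) (mem_mid V.mem hX U.mem) (λ_ X).hom
  rw [pass_unit A _ _ h1 h0] at m
  have e : pass₀ A V.obj V.obj h0 ▷ X ≫ pass A V.obj X U.obj (mem_mid V.mem hX U.mem) =
      (ρ_ _).inv ▷ X ≫ (((ρ_ _).hom ≫ pass₀ A V.obj V.obj h0 ≫ (λ_ _).inv) ▷ X ≫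
        (α_ _ _ _).hom ≫ 𝟙_ C ◁ pass A V.obj X U.obj (mem_mid V.mem hX U.mem)) ≫ (λ_ _).hom := by
    monoidal
  rw [piV, scal_whiskerRight, scal_comp, e, m]
  simp only [scal_comp, comp_scal, scal_scal, InvObj.invDim_dim, scal_one]
  have n' : pass A V.obj (𝟙_ C ⊗ X) U.obj
      (mem_mid V.mem (D.mem_tensor_one D.unit_mem hX) U.mem) =
      (dual V.obj ⊗ (A.obj ⊗ V.obj)) ◁ (λ_ X).hom ≫
        pass A V.obj X U.obj (mem_mid V.mem hX U.mem) ≫ (λ_ X).inv ▷ _ := by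
    rw [reassoc_of% n]; monoidal
  rw [n']; monoidal

theorem pass_pi (hp : IsPure C) {α : G} (V U : InvObj D α) (A : GCenter D) (X : C)
    (hX : D.deg 1 X) :
    pass A V.obj X U.obj (mem_mid V.mem hX U.mem) ≫ X ◁ piV U A =
      pass A V.obj X U.obj (mem_mid V.mem hX U.mem) := by
  have h1 := mem_mid U.mem D.unit_mem U.mem
  have h0 := D.mem_tensor_dual U.mem U.mem
  have m := pass_pass hp A V.obj U.obj X U.obj (𝟙_ C) (mem_mid V.mem hX U.mem) h1
    (mem_mid V.mem (D.mem_tensor_one hX D.unit_mem) U.mem)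
    (D.mem_tensor_dual (D.mem_tensor_one (D.mem_tensor_one V.mem hX) D.unit_mem) U.mem)
  have n := pass_natural_right A V.obj U.obj
    (mem_mid V.mem (D.mem_tensor_one hX D.unit_mem) U.mem) (mem_mid V.mem hX U.mem) (ρ_ X).hom
  rw [pass_unit A _ _ h1 h0] at m
  have e : pass A V.obj X U.obj (mem_mid V.mem hX U.mem) ≫ X ◁ pass₀ A U.obj U.obj h0 =
      (ρ_ _).inv ≫ (pass A V.obj X U.obj (mem_mid V.mem hX U.mem) ▷ 𝟙_ C ≫ (α_ _ _ _).hom ≫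
      X ◁ ((ρ_ _).hom ≫ pass₀ A U.obj U.obj h0 ≫ (λ_ _).inv)) ≫ X ◁ (λ_ _).hom := by
    monoidal
  rw [piV, hp.whiskerLeft_scal, comp_scal, e, m]
  simp only [scal_comp, comp_scal, scal_scal, InvObj.invDim_dim, scal_one]
  have n' : pass A V.obj (X ⊗ 𝟙_ C) U.obj
      (mem_mid V.mem (D.mem_tensor_one hX D.unit_mem) U.mem) =
      (dual V.obj ⊗ (A.obj ⊗ V.obj)) ◁ (ρ_ X).hom ≫
        pass A V.obj X U.obj (mem_mid V.mem hX U.mem) ≫ (ρ_ X).inv ▷ _ := by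
    rw [reassoc_of% n]; monoidal
  rw [n']; monoidal

theorem mid_mid (hp : IsPure C) {α : G} (V U T : InvObj D α) (A : GCenter D) {X Y : C}
    (hX : D.deg 1 X) (hY : D.deg 1 Y) (hXY : D.deg 1 (X ⊗ Y)) :
    mid S V U A X hX ▷ Y ≫ (α_ _ _ _).hom ≫ X ◁ mid S U T A Y hY =
      scal (dimL U.obj) ((α_ _ _ _).hom ≫ mid S V T A (X ⊗ Y) hXY ≫ (α_ _ _ _).hom) := by
  have m := pass_pass hp A V.obj U.obj X T.obj Y (mem_mid V.mem hX U.mem)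
    (mem_mid U.mem hY T.mem) (mem_mid V.mem hXY T.mem)
    (D.mem_tensor_dual (D.mem_tensor_one (D.mem_tensor_one V.mem hX) hY) T.mem)
  have c := pi_pass hp U T A Y hY
  calc _ = ((S α V A).q ▷ X) ▷ Y ≫ pass A V.obj X U.obj (mem_mid V.mem hX U.mem) ▷ Y ≫
        (α_ _ _ _).hom ≫
        X ◁ (((S α U A).p ≫ (S α U A).q) ▷ Y ≫ pass A U.obj Y T.obj (mem_mid U.mem hY T.mem)) ≫
        X ◁ (Y ◁ (S α T A).p) := by unfold mid; monoidal
    _ = _ := by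
      rw [(S α U A).p_q, c, reassoc_of% m]
      simp only [scal_comp, comp_scal]
      congr 1
      unfold mid
      monoidal

theorem mid_natural {α : G} (V U : InvObj D α) (A : GCenter D) {X Y : C}
    (hX : D.deg 1 X) (hY : D.deg 1 Y) (f : X ⟶ Y) :
    (S α V A).obj ◁ f ≫ mid S V U A Y hY = mid S V U A X hX ≫ f ▷ (S α U A).obj := by
  have n := pass_natural_right A V.obj U.obj (mem_mid V.mem hX U.mem) (mem_mid V.mem hY U.mem) f
  unfold mid
  rw [whisker_exchange_assoc, reassoc_of% n, Category.assoc, Category.assoc, whisker_exchange]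

theorem mid_natural_left (hp : IsPure C) {α : G} (V U : InvObj D α) {A B : GCenter D}
    (f : A ⟶ B) {X : C} (hX : D.deg 1 X) :
    ((S α V A).q ≫ dual V.obj ◁ (f.hom ▷ V.obj) ≫ (S α V B).p) ▷ X ≫ mid S V U B X hX =
      mid S V U A X hX ≫ X ◁ ((S α U A).q ≫ dual U.obj ◁ (f.hom ▷ U.obj) ≫ (S α U B).p) := by
  have c1 := pi_pass hp V U B X hX
  have c2 := pass_pi hp V U A X hX
  have n := pass_natural_left f V.obj X U.obj (mem_mid V.mem hX U.mem)
  rw [← (S α V B).p_q] at c1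
  rw [← (S α U A).p_q] at c2
  calc _ = (S α V A).q ▷ X ≫ (dual V.obj ◁ (f.hom ▷ V.obj)) ▷ X ≫ (((S α V B).p ≫ (S α V B).q) ▷ X
        ≫ pass B V.obj X U.obj (mem_mid V.mem hX U.mem)) ≫ X ◁ (S α U B).p := by
        unfold mid; monoidal
    _ = (S α V A).q ▷ X ≫ (pass A V.obj X U.obj (mem_mid V.mem hX U.mem) ≫
        X ◁ ((S α U A).p ≫ (S α U A).q)) ≫
        X ◁ (dual U.obj ◁ (f.hom ▷ U.obj)) ≫ X ◁ (S α U B).p := by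
        rw [c1, reassoc_of% n, c2]
    _ = _ := by unfold mid; monoidal

theorem mid_unit {α : G} (V U : InvObj D α) (A : GCenter D) :
    mid S V U A (𝟙_ C) D.unit_mem = (ρ_ _).hom ≫ ((S α V A).q ≫
      pass₀ A V.obj U.obj (D.mem_tensor_dual V.mem U.mem) ≫ (S α U A).p) ≫ (λ_ _).inv := by
  unfold mid
  rw [pass_unit A V.obj U.obj _ (D.mem_tensor_dual V.mem U.mem)]
  simp

/-- The half-braided object `φ_V(A, σ) = (E^V_A, γ^V_A)`, where
`γ^V_X = d_V⁻¹ (X ⊗ p) (ev_V ⊗ id) (V^* ⊗ σ_{V ⊗ X ⊗ V^*} ⊗ V) (id ⊗ coevt_V) (q ⊗ X)`. -/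
def phiObj (hp : IsPure C) {α : G} (V : InvObj D α) (A : GCenter D) : GCenter D :=
  RelCenter.mk' (S α V A).obj (fun X hX => scal V.invDim (mid S V V A X hX))
    D.unit_mem (fun _ h => D.dual_mem_one h) (fun _ _ h h' => D.mem_tensor_one h h')
    (fun hX hY f => by
      rw [comp_scal, scal_comp, mid_natural S V V A hX hY f])
    (fun {X Y} hX hY hXY => by
      have m := mid_mid S hp V V V A hX hY hXY
      simp only [scal_whiskerRight, hp.whiskerLeft_scal, scal_comp, comp_scal, scal_scal]
      have m' : (α_ _ _ _).inv ≫ mid S V V A X hX ▷ Y ≫ (α_ _ _ _).hom ≫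
          X ◁ mid S V V A Y hY ≫ (α_ _ _ _).inv =
          scal (dimL V.obj) (mid S V V A (X ⊗ Y) hXY) := by
        rw [reassoc_of% m]
        simp [scal_comp, comp_scal]
      rw [m', scal_scal, Category.assoc, V.invDim_dim, Category.comp_id])
    (by
      rw [mid_unit]
      have e := (S α V A).q_e_p
      change (S α V A).q ≫ scal V.invDim (pass₀ A V.obj V.obj
        (D.mem_tensor_dual V.mem V.mem)) ≫ (S α V A).p = 𝟙 _ at e
      rw [scal_comp, comp_scal] at e
      rw [← comp_scal, ← scal_comp, e, Category.id_comp])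

/-- The endofunctor `φ_V` of the `G`-center, with `φ_V(f) = p (V^* ⊗ f ⊗ V) q`. -/
def phi (hp : IsPure C) {α : G} (V : InvObj D α) : GCenter D ⥤ GCenter D where
  obj A := phiObj S hp V A
  map {A B} f :=
    { hom := (S α V A).q ≫ dual V.obj ◁ (f.hom ▷ V.obj) ≫ (S α V B).p
      comm := fun X hX => by
        have e : ((S α V A).q ≫ dual V.obj ◁ (f.hom ▷ V.obj) ≫ (S α V B).p) ▷ X ≫
            scal V.invDim (mid S V V B X hX) = scal V.invDim (mid S V V A X hX) ≫
            X ◁ ((S α V A).q ≫ dual V.obj ◁ (f.hom ▷ V.obj) ≫ (S α V B).p) := by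
          rw [comp_scal, scal_comp, mid_natural_left S hp V V f hX]
        exact e }
  map_id A := by
    ext
    change (S α V A).q ≫ dual V.obj ◁ ((𝟙 A.obj) ▷ V.obj) ≫ (S α V A).p = 𝟙 _
    simp [(S α V A).q_p]
  map_comp {A B E} f g := by
    ext
    change (S α V A).q ≫ dual V.obj ◁ ((f.hom ≫ g.hom) ▷ V.obj) ≫ (S α V E).p =
      ((S α V A).q ≫ dual V.obj ◁ (f.hom ▷ V.obj) ≫ (S α V B).p) ≫
      ((S α V B).q ≫ dual V.obj ◁ (g.hom ▷ V.obj) ≫ (S α V E).p)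
    have n2 := reassoc_of% (pi_natural V f)
    calc _ = (S α V A).q ≫ dual V.obj ◁ (f.hom ▷ V.obj) ≫
          dual V.obj ◁ (g.hom ▷ V.obj) ≫ (S α V E).p := by simp
      _ = ((S α V A).q ≫ (S α V A).p) ≫ (S α V A).q ≫ dual V.obj ◁ (f.hom ▷ V.obj) ≫
          dual V.obj ◁ (g.hom ▷ V.obj) ≫ (S α V E).p := by rw [(S α V A).q_p, Category.id_comp]
      _ = (S α V A).q ≫ piV V A ≫ dual V.obj ◁ (f.hom ▷ V.obj) ≫
          dual V.obj ◁ (g.hom ▷ V.obj) ≫ (S α V E).p := by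
          rw [Category.assoc, reassoc_of% (S α V A).p_q]
      _ = (S α V A).q ≫ dual V.obj ◁ (f.hom ▷ V.obj) ≫ ((S α V B).p ≫ (S α V B).q) ≫
          dual V.obj ◁ (g.hom ▷ V.obj) ≫ (S α V E).p := by
          rw [(S α V B).p_q, n2]
      _ = _ := by simp

/-- The morphism `d_V δ^{U,V}`. -/
def delta₀ {α : G} (V U : InvObj D α) (A : GCenter D) : (S α V A).obj ⟶ (S α U A).obj :=
  (S α V A).q ≫ pass₀ A V.obj U.obj (D.mem_tensor_dual V.mem U.mem) ≫ (S α U A).p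

theorem mid_unit' {α : G} (V U : InvObj D α) (A : GCenter D) :
    mid S V U A (𝟙_ C) D.unit_mem = (ρ_ _).hom ≫ delta₀ S V U A ≫ (λ_ _).inv :=
  mid_unit S V U A

theorem delta₀_mid (hp : IsPure C) {α : G} (V U T : InvObj D α) (A : GCenter D) (X : C)
    (hX : D.deg 1 X) :
    delta₀ S V U A ▷ X ≫ mid S U T A X hX = scal (dimL U.obj) (mid S V T A X hX) := by
  have hX' := D.mem_tensor_one D.unit_mem hX
  have m := mid_mid S hp V U T A D.unit_mem hX hX'
  have n := mid_natural S V T A hX' hX (λ_ X).hom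
  have n' : mid S V T A (𝟙_ C ⊗ X) hX' = (S α V A).obj ◁ (λ_ X).hom ≫ mid S V T A X hX ≫
      (λ_ X).inv ▷ _ := by
    rw [reassoc_of% n]; monoidal
  rw [mid_unit', n'] at m
  calc _ = (ρ_ _).inv ▷ X ≫ (((ρ_ _).hom ≫ delta₀ S V U A ≫ (λ_ _).inv) ▷ X ≫ (α_ _ _ _).hom ≫
        𝟙_ C ◁ mid S U T A X hX) ≫ (λ_ _).hom := by monoidal
    _ = _ := by
      rw [m]
      simp only [scal_comp, comp_scal]
      congr 1
      monoidal

theorem mid_delta₀ (hp : IsPure C) {α : G} (V U T : InvObj D α) (A : GCenter D) (X : C)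
    (hX : D.deg 1 X) :
    mid S V U A X hX ≫ X ◁ delta₀ S U T A = scal (dimL U.obj) (mid S V T A X hX) := by
  have hX' := D.mem_tensor_one hX D.unit_mem
  have m := mid_mid S hp V U T A hX D.unit_mem hX'
  have n := mid_natural S V T A hX' hX (ρ_ X).hom
  have n' : mid S V T A (X ⊗ 𝟙_ C) hX' = (S α V A).obj ◁ (ρ_ X).hom ≫ mid S V T A X hX ≫
      (ρ_ X).inv ▷ _ := by
    rw [reassoc_of% n]; monoidal
  rw [mid_unit', n'] at m
  calc _ = (ρ_ _).inv ≫ (mid S V U A X hX ▷ 𝟙_ C ≫ (α_ _ _ _).hom ≫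
        X ◁ ((ρ_ _).hom ≫ delta₀ S U T A ≫ (λ_ _).inv)) ≫ X ◁ (λ_ _).hom := by monoidal
    _ = _ := by
      rw [m]
      simp only [scal_comp, comp_scal]
      congr 1
      monoidal

theorem delta₀_delta₀ (hp : IsPure C) {α : G} (V U T : InvObj D α) (A : GCenter D) :
    delta₀ S V U A ≫ delta₀ S U T A = scal (dimL U.obj) (delta₀ S V T A) := by
  have m := mid_delta₀ S hp V U T A (𝟙_ C) D.unit_mem
  rw [mid_unit', mid_unit'] at m
  calc _ = (ρ_ _).inv ≫ (((ρ_ _).hom ≫ delta₀ S V U A ≫ (λ_ _).inv) ≫ 𝟙_ C ◁ delta₀ S U T A) ≫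
        (λ_ _).hom := by monoidal
    _ = _ := by
      rw [m]
      simp only [scal_comp, comp_scal]
      congr 1
      simp

theorem delta₀_natural (hp : IsPure C) {α : G} (V U : InvObj D α) {A B : GCenter D}
    (f : A ⟶ B) :
    ((S α V A).q ≫ dual V.obj ◁ (f.hom ▷ V.obj) ≫ (S α V B).p) ≫ delta₀ S V U B =
      delta₀ S V U A ≫ ((S α U A).q ≫ dual U.obj ◁ (f.hom ▷ U.obj) ≫ (S α U B).p) := by
  have m := mid_natural_left S hp V U f D.unit_mem
  rw [mid_unit', mid_unit'] at m
  generalize (S α V A).q ≫ dual V.obj ◁ (f.hom ▷ V.obj) ≫ (S α V B).p = g at m ⊢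
  generalize (S α U A).q ≫ dual U.obj ◁ (f.hom ▷ U.obj) ≫ (S α U B).p = g' at m ⊢
  calc _ = (ρ_ _).inv ≫ (g ▷ 𝟙_ C ≫ (ρ_ _).hom ≫ delta₀ S V U B ≫ (λ_ _).inv) ≫
        (λ_ _).hom := by monoidal
    _ = _ := by rw [m]; monoidal

/-- The transition `δ^{U,V} : φ_V ⟶ φ_U`,
`δ^{U,V} = d_V⁻¹ p^U (ev_V ⊗ id) (V^* ⊗ σ_{V ⊗ U^*} ⊗ U) (id ⊗ coevt_U) q^V`. -/
def delta (hp : IsPure C) {α : G} (U V : InvObj D α) : phi S hp V ⟶ phi S hp U where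
  app A :=
    { hom := scal V.invDim ((S α V A).q ≫
        pass₀ A V.obj U.obj (D.mem_tensor_dual V.mem U.mem) ≫ (S α U A).p)
      comm := fun X hX => by
        have e : scal V.invDim (delta₀ S V U A) ▷ X ≫ scal U.invDim (mid S U U A X hX) =
            scal V.invDim (mid S V V A X hX) ≫ X ◁ scal V.invDim (delta₀ S V U A) := by
          simp only [scal_whiskerRight, hp.whiskerLeft_scal, scal_comp, comp_scal]
          rw [delta₀_mid S hp, mid_delta₀ S hp, scal_comm U.invDim V.invDim,
            scal_scal U.invDim, scal_scal V.invDim (dimL _), U.invDim_dim,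
            V.invDim_dim, scal_one]
        exact e }
  naturality A B f := by
    apply RelCenter.hom_ext
    have e : ((S α V A).q ≫ dual V.obj ◁ (f.hom ▷ V.obj) ≫ (S α V B).p) ≫
        scal V.invDim (delta₀ S V U B) = scal V.invDim (delta₀ S V U A) ≫
          ((S α U A).q ≫ dual U.obj ◁ (f.hom ▷ U.obj) ≫ (S α U B).p) := by
      rw [comp_scal, scal_comp, delta₀_natural S hp]
    exact e

theorem delta_comp (hp : IsPure C) {α : G} (U V T : InvObj D α) :
    delta S hp U V ≫ delta S hp T U = delta S hp T V := by
  apply NatTrans.ext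
  funext A
  apply RelCenter.hom_ext
  have e : scal V.invDim (delta₀ S V U A) ≫ scal U.invDim (delta₀ S U T A) =
      scal V.invDim (delta₀ S V T A) := by
    rw [scal_comp, comp_scal, delta₀_delta₀ S hp, scal_scal U.invDim, U.invDim_dim, scal_one]
  exact e

theorem delta_self (hp : IsPure C) {α : G} (V : InvObj D α) :
    delta S hp V V = 𝟙 _ := by
  apply NatTrans.ext
  funext A
  apply RelCenter.hom_ext
  have e := (S α V A).q_e_p
  change (S α V A).q ≫ scal V.invDim (pass₀ A V.obj V.obj
    (D.mem_tensor_dual V.mem V.mem)) ≫ (S α V A).p = 𝟙 _ at e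
  rw [scal_comp, comp_scal] at e
  exact e

/-- The projective system `(φ_V, δ^{U,V})_{U, V ∈ E_α}`. -/
def crossingSystem (hp : IsPure C) (α : G) :
    Codiscrete (InvObj D α) ⥤ (GCenter D ⥤ GCenter D) where
  obj V := phi S hp V.as
  map {V U} _ := delta S hp U.as V.as
  map_id V := delta_self S hp V.as
  map_comp {V U T} _ _ := (delta_comp S hp U.as V.as T.as).symm

/-- A choice, for each `α`, of a projective limit `φ_α` of the system `(φ_V, δ^{U,V})` together
with its universal cone `ι^α_V : φ_α ⟶ φ_V`. -/
abbrev Crossing (hp : IsPure C) := ∀ α : G, LimitCone (crossingSystem S hp α)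

variable {S} {hp : IsPure C}

/-- The endofunctor `φ_α` of the `G`-center. -/
abbrev Crossing.functor (L : Crossing S hp) (α : G) : GCenter D ⥤ GCenter D :=
  (L α).cone.pt

/-- The universal cone `ι^α_V : φ_α ⟶ φ_V`. -/
abbrev Crossing.ι (L : Crossing S hp) {α : G} (V : InvObj D α) : L.functor α ⟶ phi S hp V :=
  (L α).cone.π.app ⟨V⟩

theorem Crossing.ι_delta (L : Crossing S hp) {α : G} (U V : InvObj D α) :
    L.ι V ≫ delta S hp U V = L.ι U :=
  (L α).cone.w (j := ⟨V⟩) (j' := ⟨U⟩) default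

theorem Crossing.isIso_ι (L : Crossing S hp) {α : G} (V : InvObj D α) : IsIso (L.ι V) := by
  have hV : IsInitial (⟨V⟩ : Codiscrete (InvObj D α)) :=
    IsInitial.ofUniqueHom (fun _ => default) (fun _ _ => rfl)
  let l : phi S hp V ⟶ L.functor α := (L α).isLimit.lift (coneOfDiagramInitial hV _)
  have hl (U : InvObj D α) : l ≫ L.ι U = delta S hp U V :=
    (L α).isLimit.fac (coneOfDiagramInitial hV _) ⟨U⟩
  refine ⟨l, (L α).isLimit.hom_ext fun U => ?_, (hl V).trans (delta_self S hp V)⟩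
  change (L.ι V ≫ l) ≫ L.ι U.as = 𝟙 _ ≫ L.ι U.as
  rw [Category.assoc, hl, Category.id_comp]
  exact L.ι_delta U.as V

theorem Crossing.isIso_ι_app (L : Crossing S hp) {α : G} (V : InvObj D α) (A : GCenter D) :
    IsIso ((L.ι V).app A).hom := by
  have := L.isIso_ι V
  infer_instance

/-- The morphism `Γ^V_{A,X} = (X ⊗ p^V_A) (σ_{X ⊗ V^*} ⊗ V) (A ⊗ X ⊗ coevt_V)`, for `X ∈ C_α` and
`V ∈ E_α`. -/
def Gam (S : Splittings D) {α : G} (V : InvObj D α) (A : GCenter D) (X : C) (hX : D.deg α X) :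
    A.obj ⊗ X ⟶ X ⊗ (S α V A).obj :=
  push A X V.obj (D.mem_tensor_dual hX V.mem) ≫ X ◁ (S α V A).p

theorem push_pass₀ (hp : IsPure C) (A : GCenter D) (W V U : C) (h : D.deg 1 (W ⊗ dual V))
    (h' : D.deg 1 (V ⊗ dual U)) (h'' : D.deg 1 (W ⊗ dual U))
    (h1 : D.deg 1 ((V ⊗ 𝟙_ C) ⊗ dual U)) (h2 : D.deg 1 ((W ⊗ 𝟙_ C) ⊗ dual U)) :
    push A W V h ≫ W ◁ pass₀ A V U h' = scal (dimL V) (push A W U h'') := by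
  have m := push_pass hp A W V (𝟙_ C) U h h1 h2
  have n := push_natural A U h2 h'' (ρ_ W).hom
  have n' : push A (W ⊗ 𝟙_ C) U h2 = A.obj ◁ (ρ_ W).hom ≫ push A W U h'' ≫ (ρ_ W).inv ▷ _ := by
    rw [reassoc_of% n]; monoidal
  rw [pass_unit A V U h1 h', n'] at m
  calc _ = (ρ_ _).inv ≫ (push A W V h ▷ 𝟙_ C ≫ (α_ _ _ _).hom ≫
        W ◁ ((ρ_ _).hom ≫ pass₀ A V U h' ≫ (λ_ _).inv)) ≫ W ◁ (λ_ _).hom := by monoidal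
    _ = _ := by
      rw [m]
      simp only [scal_comp, comp_scal]
      congr 1
      monoidal

theorem Gam_delta₀ (hp : IsPure C) {α : G} (V U : InvObj D α) (A : GCenter D) (X : C)
    (hX : D.deg α X) :
    Gam S V A X hX ≫ X ◁ delta₀ S V U A = scal (dimL V.obj) (Gam S U A X hX) := by
  have hV := D.mem_tensor_dual hX V.mem
  have hU := D.mem_tensor_dual hX U.mem
  have m (T : InvObj D α) := push_pass₀ hp A X V.obj T.obj hV (D.mem_tensor_dual V.mem T.mem)
    (D.mem_tensor_dual hX T.mem) (mem_mid V.mem D.unit_mem T.mem) (mem_mid hX D.unit_mem T.mem)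
  have m' : push A X V.obj hV ≫ X ◁ piV V A = push A X V.obj hV := by
    rw [piV, hp.whiskerLeft_scal, comp_scal, m, scal_scal, V.invDim_dim, scal_one]
  calc _ = (push A X V.obj hV ≫ X ◁ ((S α V A).p ≫ (S α V A).q)) ≫
        X ◁ pass₀ A V.obj U.obj (D.mem_tensor_dual V.mem U.mem) ≫ X ◁ (S α U A).p := by
        unfold Gam delta₀; simp
    _ = _ := by
        rw [(S α V A).p_q, m', reassoc_of% (m U), scal_comp]; rfl

theorem exists_tau (hn : NonSingular D) (L : Crossing S hp) {α : G} (A : GCenter D) (X : C)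
    (hX : D.deg α X) :
    ∃! t : A.obj ⊗ X ⟶ X ⊗ ((L.functor α).obj A).obj,
      ∀ V : InvObj D α, t ≫ X ◁ ((L.ι V).app A).hom = Gam S V A X hX := by
  refine existsUnique_lift X (fun V : InvObj D α => (S α V A).obj) (fun V => ((L.ι V).app A).hom)
    (fun V => L.isIso_ι_app V A) (fun V U => scal V.invDim (delta₀ S V U A)) (fun V U => ?_)
    (fun V => Gam S V A X hX) (fun V U => ?_) (hn.exists_inv α)
  · rw [← L.ι_delta U V]; rfl
  · rw [hp.whiskerLeft_scal, comp_scal, Gam_delta₀ hp, scal_scal, V.invDim_dim, scal_one]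

/-- The enhanced `G`-braiding `τ_{A,X} : A ⊗ X ⟶ X ⊗ φ_α(A)` for `A` in the `G`-center and
`X ∈ C_α`: the unique morphism such that `(X ⊗ (ι^α_V)_A) τ_{A,X} = Γ^V_{A,X}` for all
`V ∈ E_α`. -/
def tau (hn : NonSingular D) (L : Crossing S hp) {α : G} (A : GCenter D) (X : C)
    (hX : D.deg α X) : A.obj ⊗ X ⟶ X ⊗ ((L.functor α).obj A).obj :=
  (exists_tau hn L A X hX).choose

theorem tau_ι (hn : NonSingular D) (L : Crossing S hp) {α : G} (A : GCenter D) (X : C)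
    (hX : D.deg α X) (V : InvObj D α) :
    tau hn L A X hX ≫ X ◁ ((L.ι V).app A).hom = Gam S V A X hX :=
  (exists_tau hn L A X hX).choose_spec.1 V

end Crossing

end

end GCat

namespace GCat

noncomputable section

section Centralizer

variable {C : Type u} [Category.{v} C] [MonoidalCategory C] [PivotalCategory C]

theorem dualMap_id (X : C) : dualMap (𝟙 X) = 𝟙 (dual X) :=
  letI (X : C) : HasRightDual X := ⟨dual X⟩
  rightAdjointMate_id

theorem dualMap_comp {X Y Z : C} (f : X ⟶ Y) (g : Y ⟶ Z) :
    dualMap (f ≫ g) = dualMap g ≫ dualMap f :=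
  letI (X : C) : HasRightDual X := ⟨dual X⟩
  comp_rightAdjointMate

theorem coev_dualMap {X Y : C} (f : X ⟶ Y) :
    coev Y ≫ Y ◁ dualMap f = coev X ≫ f ▷ dual X :=
  letI (X : C) : HasRightDual X := ⟨dual X⟩
  coevaluation_comp_rightAdjointMate f

theorem dualMap_ev {X Y : C} (f : X ⟶ Y) :
    dualMap f ▷ X ≫ ev X = dual Y ◁ f ≫ ev Y :=
  letI (X : C) : HasRightDual X := ⟨dual X⟩
  rightAdjointMate_comp_evaluation f

variable (P : ObjectProperty C)

/-- The functor `(Y, Y') ↦ Y^* ⊗ X ⊗ Y'` on the full subcategory given by `P`. -/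
def conjFunctor (X : C) : P.FullSubcategoryᵒᵖ ⥤ P.FullSubcategory ⥤ C where
  obj Y :=
    { obj Y' := dual Y.unop.obj ⊗ (X ⊗ Y'.obj)
      map f := dual Y.unop.obj ◁ (X ◁ f.hom) }
  map f :=
    { app Y' := dualMap f.unop.hom ▷ (X ⊗ Y'.obj)
      naturality Y' Y'' g := by
        have e := whisker_exchange (dualMap f.unop.hom) (X ◁ g.hom)
        exact e }
  map_id Y := by
    ext Y'
    change dualMap (𝟙 Y.unop.obj) ▷ (X ⊗ Y'.obj) = 𝟙 _
    rw [dualMap_id, id_whiskerRight]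
  map_comp f g := by
    ext Y'
    change dualMap (g.unop.hom ≫ f.unop.hom) ▷ (X ⊗ Y'.obj) =
      dualMap f.unop.hom ▷ (X ⊗ Y'.obj) ≫ dualMap g.unop.hom ▷ (X ⊗ Y'.obj)
    rw [dualMap_comp, comp_whiskerRight]

/-- A centralizer relative to the full subcategory given by `P`: a choice, for each object `X`
of `C`, of a coend `Z(X)` of the functor `(Y, Y') ↦ Y^* ⊗ X ⊗ Y'`, where `Y`, `Y'` satisfy `P`. -/
structure Centralizer where
  cowedge (X : C) : Cowedge (conjFunctor P X)
  isColimit (X : C) : IsColimit (cowedge X)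

namespace Centralizer

variable {P} (Z : Centralizer P)

/-- The object `Z(X)`. -/
def obj (X : C) : C := (Z.cowedge X).pt

/-- The universal dinatural transformation `ρ_{X,Y} : Y^* ⊗ X ⊗ Y ⟶ Z(X)`. -/
def rho (X Y : C) (hY : P Y) : dual Y ⊗ (X ⊗ Y) ⟶ Z.obj X := (Z.cowedge X).π ⟨Y, hY⟩

/-- The morphism `∂_{X,Y} = (Y ⊗ ρ_{X,Y}) (coev_Y ⊗ X ⊗ Y) : X ⊗ Y ⟶ Y ⊗ Z(X)`. -/
def part (X Y : C) (hY : P Y) : X ⊗ Y ⟶ Y ⊗ Z.obj X :=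
  (λ_ _).inv ≫ coev Y ▷ (X ⊗ Y) ≫ (α_ _ _ _).hom ≫ Y ◁ Z.rho X Y hY

theorem rho_dinatural (X : C) {Y Y' : C} (hY : P Y) (hY' : P Y') (f : Y ⟶ Y') :
    dualMap f ▷ (X ⊗ Y) ≫ Z.rho X Y hY = dual Y' ◁ (X ◁ f) ≫ Z.rho X Y' hY' :=
  (Z.cowedge X).condition (i := ⟨Y, hY⟩) (j := ⟨Y', hY'⟩) (ObjectProperty.homMk f)

theorem rho_eq (X Y : C) (hY : P Y) :
    Z.rho X Y hY = dual Y ◁ Z.part X Y hY ≫ (α_ _ _ _).inv ≫ ev Y ▷ Z.obj X ≫ (λ_ _).hom := by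
  symm
  calc _ = 𝟙 _ ⊗≫ dual Y ◁ coev Y ▷ (X ⊗ Y) ⊗≫ ((dual Y ⊗ Y) ◁ Z.rho X Y hY ≫ ev Y ▷ Z.obj X) ⊗≫
        𝟙 _ := by unfold part; monoidal
    _ = 𝟙 _ ⊗≫ (dual Y ◁ coev Y ⊗≫ ev Y ▷ dual Y) ▷ (X ⊗ Y) ⊗≫ Z.rho X Y hY := by
        rw [whisker_exchange]; monoidal
    _ = _ := by rw [ExactPairing.coevaluation_evaluation'']; monoidal

theorem part_natural (X : C) {Y Y' : C} (hY : P Y) (hY' : P Y') (f : Y ⟶ Y') :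
    X ◁ f ≫ Z.part X Y' hY' = Z.part X Y hY ≫ f ▷ Z.obj X := by
  have n := Z.rho_dinatural X hY hY' f
  have c := coev_dualMap f
  symm
  calc _ = (λ_ _).inv ≫ coev Y ▷ (X ⊗ Y) ≫ (α_ _ _ _).hom ≫ (Y ◁ Z.rho X Y hY ≫
        f ▷ Z.obj X) := by unfold part; simp
    _ = (λ_ _).inv ≫ (coev Y ≫ f ▷ dual Y) ▷ (X ⊗ Y) ≫ (α_ _ _ _).hom ≫ Y' ◁ Z.rho X Y hY := by
        rw [whisker_exchange]; monoidal
    _ = (λ_ _).inv ≫ coev Y' ▷ (X ⊗ Y) ≫ (α_ _ _ _).hom ≫ Y' ◁ (dualMap f ▷ (X ⊗ Y) ≫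
          Z.rho X Y hY) := by
        rw [← c]; monoidal
    _ = 𝟙 _ ⊗≫ (coev Y' ▷ (X ⊗ Y) ≫ (Y' ⊗ dual Y') ◁ (X ◁ f)) ⊗≫ Y' ◁ Z.rho X Y' hY' := by
        rw [n]; monoidal
    _ = _ := by
        rw [← whisker_exchange]; unfold part; monoidal

theorem existsUnique (X B : C) (s : ∀ Y, P Y → (X ⊗ Y ⟶ Y ⊗ B))
    (hs : ∀ (Y Y' : C) (hY : P Y) (hY' : P Y') (f : Y ⟶ Y'),
      X ◁ f ≫ s Y' hY' = s Y hY ≫ f ▷ B) :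
    ∃! r : Z.obj X ⟶ B, ∀ (Y : C) (hY : P Y), Z.part X Y hY ≫ Y ◁ r = s Y hY := by
  let d (Y : C) (hY : P Y) : dual Y ⊗ (X ⊗ Y) ⟶ B :=
    dual Y ◁ s Y hY ≫ (α_ _ _ _).inv ≫ ev Y ▷ B ≫ (λ_ _).hom
  have hd {Y Y' : C} (hY : P Y) (hY' : P Y') (f : Y ⟶ Y') :
      dualMap f ▷ (X ⊗ Y) ≫ d Y hY = dual Y' ◁ (X ◁ f) ≫ d Y' hY' := by
    calc _ = (dualMap f ▷ (X ⊗ Y) ≫ dual Y ◁ s Y hY) ≫ (α_ _ _ _).inv ≫ ev Y ▷ B ≫ (λ_ _).hom := by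
          simp [d]
      _ = dual Y' ◁ s Y hY ≫ (α_ _ _ _).inv ≫ (dualMap f ▷ Y ≫ ev Y) ▷ B ≫ (λ_ _).hom := by
          rw [← whisker_exchange]; monoidal
      _ = dual Y' ◁ (s Y hY ≫ f ▷ B) ≫ (α_ _ _ _).inv ≫ ev Y' ▷ B ≫ (λ_ _).hom := by
          rw [dualMap_ev]; monoidal
      _ = _ := by rw [← hs Y Y' hY hY' f]; simp [d]
  have key (r : Z.obj X ⟶ B) (Y : C) (hY : P Y) :
      Z.part X Y hY ≫ Y ◁ r = s Y hY ↔ Z.rho X Y hY ≫ r = d Y hY := by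
    constructor
    · intro h
      simp only [d]
      rw [← h, rho_eq]
      calc _ = dual Y ◁ Z.part X Y hY ≫ (α_ _ _ _).inv ≫ (ev Y ▷ Z.obj X ≫ 𝟙_ C ◁ r) ≫
            (λ_ _).hom := by monoidal
        _ = _ := by rw [← whisker_exchange]; monoidal
    · intro h
      calc _ = (λ_ _).inv ≫ coev Y ▷ (X ⊗ Y) ≫ (α_ _ _ _).hom ≫ Y ◁ (Z.rho X Y hY ≫ r) := by
            unfold part; simp
        _ = 𝟙 _ ⊗≫ (coev Y ▷ (X ⊗ Y) ≫ (Y ⊗ dual Y) ◁ s Y hY) ⊗≫ Y ◁ (ev Y ▷ B) ⊗≫ 𝟙 _ := by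
            rw [h]; simp only [d]; monoidal
        _ = 𝟙 _ ⊗≫ s Y hY ⊗≫ (coev Y ▷ Y ⊗≫ Y ◁ ev Y) ▷ B ⊗≫ 𝟙 _ := by
            rw [← whisker_exchange]; monoidal
        _ = _ := by rw [ExactPairing.evaluation_coevaluation'']; monoidal
  let r : Z.obj X ⟶ B := Cowedge.IsColimit.desc (Z.isColimit X)
    (fun Y => d Y.obj Y.property) (fun Y Y' f => hd Y.property Y'.property f.hom)
  have hr (Y : C) (hY : P Y) : Z.rho X Y hY ≫ r = d Y hY :=
    Cowedge.IsColimit.π_desc (Z.isColimit X) (fun Y => d Y.obj Y.property)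
      (fun Y Y' f => hd Y.property Y'.property f.hom) ⟨Y, hY⟩
  refine ⟨r, fun Y hY => (key r Y hY).2 (hr Y hY), fun r' h' => ?_⟩
  refine Cowedge.IsColimit.hom_ext (Z.isColimit X) fun Y => ?_
  exact ((key r' _ _).1 (h' Y.obj Y.property)).trans (hr Y.obj Y.property).symm

theorem transpose_def {A Q B : C} (f : A ⊗ Q ⟶ B) :
    tensorRightHomEquiv A Q (dual Q) B f =
      (ρ_ _).inv ≫ _ ◁ coev Q ≫ (α_ _ _ _).inv ≫ f ▷ _ := rfl

theorem transpose_eq {A Y E Q B : C} (h : A ⟶ Y ⊗ E) (r : E ⊗ Q ⟶ B) :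
    tensorRightHomEquiv A Q (dual Q) (Y ⊗ B) (h ▷ Q ≫ (α_ _ _ _).hom ≫ Y ◁ r) =
      h ≫ Y ◁ (tensorRightHomEquiv E Q (dual Q) B r) ≫ (α_ _ _ _).inv := by
  rw [transpose_def, transpose_def]
  calc _ = 𝟙 _ ⊗≫ (A ◁ coev Q ≫ h ▷ (Q ⊗ dual Q)) ⊗≫ Y ◁ (r ▷ dual Q) ⊗≫ 𝟙 _ := by monoidal
    _ = _ := by rw [whisker_exchange]; monoidal

theorem existsUnique_param (X Q B : C) (s : ∀ Y, P Y → ((X ⊗ Y) ⊗ Q ⟶ Y ⊗ B))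
    (hs : ∀ (Y Y' : C) (hY : P Y) (hY' : P Y') (f : Y ⟶ Y'),
      (X ◁ f) ▷ Q ≫ s Y' hY' = s Y hY ≫ f ▷ B) :
    ∃! r : Z.obj X ⊗ Q ⟶ B, ∀ (Y : C) (hY : P Y),
      Z.part X Y hY ▷ Q ≫ (α_ _ _ _).hom ≫ Y ◁ r = s Y hY := by
  obtain ⟨r', h1, h2⟩ := Z.existsUnique X (B ⊗ dual Q)
    (fun Y hY => tensorRightHomEquiv (X ⊗ Y) Q (dual Q) (Y ⊗ B) (s Y hY) ≫ (α_ _ _ _).hom)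
    (fun Y Y' hY hY' f => by
      have := hs Y Y' hY hY' f
      rw [transpose_def, transpose_def]
      calc _ = 𝟙 _ ⊗≫ ((X ◁ f) ▷ 𝟙_ C ≫ (X ⊗ Y') ◁ coev Q) ⊗≫ s Y' hY' ▷ dual Q ⊗≫ 𝟙 _ := by
            monoidal
        _ = 𝟙 _ ⊗≫ ((X ⊗ Y) ◁ coev Q) ⊗≫ ((X ◁ f) ▷ Q ≫ s Y' hY') ▷ dual Q ⊗≫ 𝟙 _ := by
            rw [← whisker_exchange]; monoidal
        _ = _ := by rw [this]; monoidal)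
  have key (r : Z.obj X ⊗ Q ⟶ B) (Y : C) (hY : P Y) :
      Z.part X Y hY ▷ Q ≫ (α_ _ _ _).hom ≫ Y ◁ r = s Y hY ↔
      Z.part X Y hY ≫ Y ◁ (tensorRightHomEquiv (Z.obj X) Q (dual Q) B r) =
        tensorRightHomEquiv (X ⊗ Y) Q (dual Q) (Y ⊗ B) (s Y hY) ≫ (α_ _ _ _).hom := by
    rw [← (tensorRightHomEquiv (X ⊗ Y) Q (dual Q) (Y ⊗ B)).apply_eq_iff_eq, transpose_eq,
      ← Category.assoc, Iso.comp_inv_eq]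
  refine ⟨(tensorRightHomEquiv (Z.obj X) Q (dual Q) B).symm r', fun Y hY => ?_, fun r hr => ?_⟩
  · rw [key, Equiv.apply_symm_apply]; exact h1 Y hY
  · rw [Equiv.eq_symm_apply]
    exact h2 _ fun Y hY => (key r Y hY).1 (hr Y hY)

theorem param_ext {X Q B : C} {r r' : Z.obj X ⊗ Q ⟶ B} (h : ∀ (Y : C) (hY : P Y),
    Z.part X Y hY ▷ Q ≫ (α_ _ _ _).hom ≫ Y ◁ r =
      Z.part X Y hY ▷ Q ≫ (α_ _ _ _).hom ≫ Y ◁ r') : r = r' := by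
  refine (Z.existsUnique_param X Q B
    (fun Y hY => Z.part X Y hY ▷ Q ≫ (α_ _ _ _).hom ≫ Y ◁ r')
    (fun Y Y' hY hY' f => ?_)).unique h (fun _ _ => rfl)
  have n := Z.part_natural X hY hY' f
  calc _ = (X ◁ f ≫ Z.part X Y' hY') ▷ Q ≫ (α_ _ _ _).hom ≫ Y' ◁ r' := by monoidal
    _ = Z.part X Y hY ▷ Q ≫ (α_ _ _ _).hom ≫ (f ▷ _ ≫ Y' ◁ r') := by rw [n]; monoidal
    _ = _ := by rw [← whisker_exchange]; monoidal

end Centralizer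

end Centralizer

end

end GCat

namespace GCat

noncomputable section

section Free

variable {G : Type w} [Group G] {C : Type u} [Category.{v} C] [MonoidalCategory C]
  [PivotalCategory C] [Preadditive C] [HasFiniteBiproducts C] {D : PivotalGrading G C}

theorem PivotalGrading.mem_tensor_eq (D : PivotalGrading G C) {α β γ : G} (h : α * β = γ) {X Y : C}
    (hX : D.deg α X) (hY : D.deg β Y) : D.deg γ (X ⊗ Y) :=
  D.mem_cast (D.tensor_mem hX hY) h

variable (Z : ∀ α : G, Centralizer (D.deg α))

theorem existsUnique_mix {α β γ : G} (h : α * β = γ) (X Y : C) (hY : D.deg β Y) :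
    ∃! r : (Z α).obj X ⊗ Y ⟶ Y ⊗ (Z γ).obj X, ∀ (W : C) (hW : D.deg α W),
      (Z α).part X W hW ▷ Y ≫ (α_ _ _ _).hom ≫ W ◁ r =
        (α_ _ _ _).hom ≫ (Z γ).part X (W ⊗ Y) (D.mem_tensor_eq h hW hY) ≫ (α_ _ _ _).hom :=
  (Z α).existsUnique_param X Y (Y ⊗ (Z γ).obj X)
    (fun W hW => (α_ _ _ _).hom ≫ (Z γ).part X (W ⊗ Y) (D.mem_tensor_eq h hW hY) ≫ (α_ _ _ _).hom)
    (fun W W' hW hW' f => by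
      have n := (Z γ).part_natural X (D.mem_tensor_eq h hW hY) (D.mem_tensor_eq h hW' hY) (f ▷ Y)
      calc _ = (α_ _ _ _).hom ≫ (X ◁ (f ▷ Y) ≫ (Z γ).part X (W' ⊗ Y) (D.mem_tensor_eq h hW' hY)) ≫
            (α_ _ _ _).hom := by monoidal
        _ = _ := by rw [n]; monoidal)

/-- The morphism `(Y ⊗ Z_2(β,α)_X) ∂^β_{Z_α(X),Y} : Z_α(X) ⊗ Y ⟶ Y ⊗ Z_{αβ}(X)` -/
def mix {α β γ : G} (h : α * β = γ) (X Y : C) (hY : D.deg β Y) :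
    (Z α).obj X ⊗ Y ⟶ Y ⊗ (Z γ).obj X :=
  (existsUnique_mix Z h X Y hY).choose

theorem mix_spec {α β γ : G} (h : α * β = γ) (X Y : C) (hY : D.deg β Y) (W : C)
    (hW : D.deg α W) : (Z α).part X W hW ▷ Y ≫ (α_ _ _ _).hom ≫ W ◁ mix Z h X Y hY =
      (α_ _ _ _).hom ≫ (Z γ).part X (W ⊗ Y) (D.mem_tensor_eq h hW hY) ≫ (α_ _ _ _).hom :=
  (existsUnique_mix Z h X Y hY).choose_spec.1 W hW

theorem mix_natural {α β γ : G} (h : α * β = γ) (X : C) {Y Y' : C} (hY : D.deg β Y)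
    (hY' : D.deg β Y') (f : Y ⟶ Y') :
    (Z α).obj X ◁ f ≫ mix Z h X Y' hY' = mix Z h X Y hY ≫ f ▷ (Z γ).obj X := by
  refine (Z α).param_ext fun W hW => ?_
  have n := (Z γ).part_natural X (D.mem_tensor_eq h hW hY) (D.mem_tensor_eq h hW hY') (W ◁ f)
  calc _ = ((Z α).part X W hW ▷ Y ≫ (W ⊗ (Z α).obj X) ◁ f) ≫ (α_ _ _ _).hom ≫
        W ◁ mix Z h X Y' hY' := by monoidal
    _ = (X ⊗ W) ◁ f ≫ ((Z α).part X W hW ▷ Y' ≫ (α_ _ _ _).hom ≫ W ◁ mix Z h X Y' hY') := by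
        rw [← whisker_exchange]; monoidal
    _ = (α_ _ _ _).hom ≫ (X ◁ (W ◁ f) ≫
        (Z γ).part X (W ⊗ Y') (D.mem_tensor_eq h hW hY')) ≫ (α_ _ _ _).hom := by
        rw [mix_spec]; monoidal
    _ = ((α_ _ _ _).hom ≫ (Z γ).part X (W ⊗ Y) (D.mem_tensor_eq h hW hY) ≫ (α_ _ _ _).hom) ≫
        W ◁ (f ▷ (Z γ).obj X) := by rw [n]; monoidal
    _ = _ := by rw [← mix_spec Z h X Y hY W hW]; monoidal

theorem mix_mix {α β γ β' δ ε : G} (h : α * β = γ) (h' : γ * β' = δ) (h'' : α * ε = δ) (X : C)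
    {Y Y' : C} (hY : D.deg β Y) (hY' : D.deg β' Y') (hYY : D.deg ε (Y ⊗ Y')) :
    mix Z h X Y hY ▷ Y' ≫ (α_ _ _ _).hom ≫ Y ◁ mix Z h' X Y' hY' =
      (α_ _ _ _).hom ≫ mix Z h'' X (Y ⊗ Y') hYY ≫ (α_ _ _ _).hom := by
  have key : (α_ _ _ _).inv ≫ mix Z h X Y hY ▷ Y' ≫ (α_ _ _ _).hom ≫ Y ◁ mix Z h' X Y' hY' ≫
      (α_ _ _ _).inv = mix Z h'' X (Y ⊗ Y') hYY := by
    refine (Z α).param_ext fun W hW => ?_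
    have hWY := D.mem_tensor_eq h hW hY
    have n := (Z δ).part_natural X (D.mem_tensor_eq h' hWY hY') (D.mem_tensor_eq h'' hW hYY)
      (α_ W Y Y').hom
    calc _ = (α_ _ _ _).inv ≫ ((Z α).part X W hW ▷ Y ≫ (α_ _ _ _).hom ≫ W ◁ mix Z h X Y hY) ▷ Y' ≫
          (α_ _ _ _).hom ≫ W ◁ (α_ _ _ _).hom ≫ W ◁ (Y ◁ mix Z h' X Y' hY') ≫
          W ◁ (α_ _ _ _).inv := by monoidal
      _ = (α_ _ _ _).inv ≫ (α_ _ _ _).hom ▷ Y' ≫ ((Z γ).part X (W ⊗ Y) hWY ▷ Y' ≫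
          (α_ _ _ _).hom ≫ (W ⊗ Y) ◁ mix Z h' X Y' hY') ≫ (α_ _ _ _).hom ≫
          W ◁ (α_ _ _ _).inv := by rw [mix_spec]; monoidal
      _ = (α_ _ _ _).inv ≫ (α_ _ _ _).hom ▷ Y' ≫ (α_ _ _ _).hom ≫
          ((Z δ).part X ((W ⊗ Y) ⊗ Y') (D.mem_tensor_eq h' hWY hY') ≫ (α_ W Y Y').hom ▷ _) ≫
          (α_ _ _ _).hom := by rw [mix_spec]; monoidal
      _ = _ := by rw [← n, mix_spec]; monoidal
  rw [← key]; monoidal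

theorem mix_unit {α : G} (h : α * 1 = α) (X : C) :
    mix Z h X (𝟙_ C) D.unit_mem = (ρ_ _).hom ≫ (λ_ _).inv := by
  refine (Z α).param_ext fun W hW => ?_
  have n := (Z α).part_natural X (D.mem_tensor_eq h hW D.unit_mem) hW (ρ_ W).hom
  have n' : (Z α).part X (W ⊗ 𝟙_ C) (D.mem_tensor_eq h hW D.unit_mem) =
      X ◁ (ρ_ W).hom ≫ (Z α).part X W hW ≫ (ρ_ W).inv ▷ _ := by
    rw [reassoc_of% n]; monoidal
  rw [mix_spec, n']; monoidal

theorem existsUnique_Z2 {α β γ : G} (h : β * α = γ) (X : C) :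
    ∃! r : (Z α).obj ((Z β).obj X) ⟶ (Z γ).obj X, ∀ (Y Y' : C) (hY : D.deg α Y)
      (hY' : D.deg β Y'), (Z β).part X Y' hY' ▷ Y ≫ (α_ _ _ _).hom ≫
        Y' ◁ ((Z α).part ((Z β).obj X) Y hY ≫ Y ◁ r) =
      (α_ _ _ _).hom ≫ (Z γ).part X (Y' ⊗ Y) (D.mem_tensor_eq h hY' hY) ≫ (α_ _ _ _).hom := by
  obtain ⟨r, h1, h2⟩ := (Z α).existsUnique ((Z β).obj X) ((Z γ).obj X)
    (fun Y hY => mix Z h X Y hY) (fun Y Y' hY hY' f => mix_natural Z h X hY hY' f)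
  refine ⟨r, fun Y Y' hY hY' => ?_, fun r' hr' => h2 _ fun Y hY => ?_⟩
  · rw [h1 Y hY, mix_spec]
  · refine (Z β).param_ext fun Y' hY' => ?_
    rw [hr' Y Y' hY hY', mix_spec]

/-- The morphism `Z_2(α,β)_X : Z_α(Z_β(X)) ⟶ Z_γ(X)`, where `γ = βα`: the unique one such that
`(Y' ⊗ ((Y ⊗ Z_2(α,β)_X) ∂^α_{Z_β(X),Y})) (∂^β_{X,Y'} ⊗ Y) = ∂^γ_{X,Y' ⊗ Y}` for all `Y ∈ C_α` and
`Y' ∈ C_β`. -/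
def Z2 {α β γ : G} (h : β * α = γ) (X : C) : (Z α).obj ((Z β).obj X) ⟶ (Z γ).obj X :=
  (existsUnique_Z2 Z h X).choose

theorem Z2_spec {α β γ : G} (h : β * α = γ) (X Y Y' : C) (hY : D.deg α Y) (hY' : D.deg β Y') :
    (Z β).part X Y' hY' ▷ Y ≫ (α_ _ _ _).hom ≫
        Y' ◁ ((Z α).part ((Z β).obj X) Y hY ≫ Y ◁ Z2 Z h X) =
      (α_ _ _ _).hom ≫ (Z γ).part X (Y' ⊗ Y) (D.mem_tensor_eq h hY' hY) ≫ (α_ _ _ _).hom :=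
  (existsUnique_Z2 Z h X).choose_spec.1 Y Y' hY hY'

theorem part_Z2 {α β γ : G} (h : β * α = γ) (X Y : C) (hY : D.deg α Y) :
    (Z α).part ((Z β).obj X) Y hY ≫ Y ◁ Z2 Z h X = mix Z h X Y hY :=
  (Z β).param_ext fun Y' hY' => by rw [Z2_spec, mix_spec]

/-- The free object `F_α(X) = (Z_α(X), σ^α_X)` of the `G`-center, where
`σ^α_{X,Y} = (Y ⊗ Z_2(1,α)_X) ∂^1_{Z_α(X),Y}`. -/
def free (α : G) (X : C) : GCenter D :=
  RelCenter.mk' ((Z α).obj X)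
    (fun Y hY => (Z 1).part ((Z α).obj X) Y hY ≫ Y ◁ Z2 Z (mul_one α) X)
    D.unit_mem (fun _ h => D.dual_mem_one h) (fun _ _ h h' => D.mem_tensor_one h h')
    (fun hY hY' f => by rw [part_Z2, part_Z2, mix_natural])
    (fun {Y Y'} hY hY' hYY => by
      rw [part_Z2, part_Z2, part_Z2]
      have m := mix_mix Z (mul_one α) (mul_one α) (mul_one α) X hY hY' hYY
      rw [reassoc_of% m]
      monoidal)
    (by rw [part_Z2, mix_unit])

theorem free_braid (α : G) (X Y : C) (hY : D.deg 1 Y) :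
    ((free Z α X).braid Y hY).hom = mix Z (mul_one α) X Y hY :=
  part_Z2 Z (mul_one α) X Y hY

/-- A family of morphisms `A ⊗ W ⟶ W ⊗ B`, for `W ∈ C_β`, compatible with half-braidings. -/
structure Intertwiner (A B : GCenter D) (β : G) where
  map (W : C) (hW : D.deg β W) : A.obj ⊗ W ⟶ W ⊗ B.obj
  natural {W W' : C} (hW : D.deg β W) (hW' : D.deg β W') (f : W ⟶ W') :
    A.obj ◁ f ≫ map W' hW' = map W hW ≫ f ▷ B.obj
  left {Y W : C} (hY : D.deg 1 Y) (hW : D.deg β W) (hYW : D.deg β (Y ⊗ W)) :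
    (A.braid Y hY).hom ▷ W ≫ (α_ _ _ _).hom ≫ Y ◁ map W hW =
      (α_ _ _ _).hom ≫ map (Y ⊗ W) hYW ≫ (α_ _ _ _).hom
  right {W Y : C} (hW : D.deg β W) (hY : D.deg 1 Y) (hWY : D.deg β (W ⊗ Y)) :
    map W hW ▷ Y ≫ (α_ _ _ _).hom ≫ W ◁ (B.braid Y hY).hom =
      (α_ _ _ _).hom ≫ map (W ⊗ Y) hWY ≫ (α_ _ _ _).hom

/-- The morphism `(ev_V ⊗ B) (V^* ⊗ m) : V^* ⊗ A ⊗ V ⟶ B` for `m : A ⊗ V ⟶ V ⊗ B`. -/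
def absorb {A B V : C} (m : A ⊗ V ⟶ V ⊗ B) : dual V ⊗ (A ⊗ V) ⟶ B :=
  dual V ◁ m ≫ (α_ _ _ _).inv ≫ ev V ▷ _ ≫ (λ_ _).hom

section Intertwiner

variable {A B : GCenter D} {β : G} (m : Intertwiner A B β)

theorem push_absorb (hp : IsPure C) (W U : C) (hW : D.deg β W)
    (hU : D.deg β U) (hWU : D.deg 1 (W ⊗ dual U)) :
    push A W U hWU ≫ W ◁ absorb (m.map U hU) = scal (dimL U) (m.map W hW) := by
  have hm : D.deg β ((W ⊗ dual U) ⊗ U) := D.mem_one_tensor hWU hU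
  have l := m.left hWU hU hm
  let f : (W ⊗ dual U) ⊗ U ⟶ W := (α_ _ _ _).hom ≫ W ◁ ev U ≫ (ρ_ _).hom
  have n := m.natural hm hW f
  calc _ = 𝟙 _ ⊗≫ (A.obj ⊗ W) ◁ coevt U ⊗≫
        ((A.braid (W ⊗ dual U) hWU).hom ▷ U ≫ (α_ _ _ _).hom ≫
        (W ⊗ dual U) ◁ m.map U hU) ⊗≫ W ◁ (ev U ▷ B.obj) ⊗≫ 𝟙 _ := by
        unfold push absorb; monoidal
    _ = 𝟙 _ ⊗≫ (A.obj ⊗ W) ◁ coevt U ⊗≫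
        (m.map ((W ⊗ dual U) ⊗ U) hm ≫ f ▷ _) ⊗≫ 𝟙 _ := by
        rw [l]; simp only [f]; monoidal
    _ = 𝟙 _ ⊗≫ A.obj ◁ (W ◁ (coevt U ≫ ev U)) ⊗≫ m.map W hW := by
        rw [← n]; simp only [f]; monoidal
    _ = 𝟙 _ ⊗≫ A.obj ◁ (W ◁ (dimL U ▷ 𝟙_ C)) ⊗≫ m.map W hW := by
        simp only [dimL]; monoidal
    _ = _ := by
        rw [whiskerRight_eq_scal]
        simp only [hp.whiskerLeft_scal, scal_monoidalComp, monoidalComp_scal]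
        congr 1
        monoidal

theorem pass_absorb (hp : IsPure C) (V Y U : C) (hV : D.deg β V) (hU : D.deg β U)
    (hY : D.deg 1 Y) (hVU : D.deg 1 ((V ⊗ Y) ⊗ dual U)) :
    pass A V Y U hVU ≫ Y ◁ absorb (m.map U hU) =
      scal (dimL U) (absorb (m.map V hV) ▷ Y ≫ (B.braid Y hY).hom) := by
  have hVY := D.mem_tensor_one hV hY
  have p := push_absorb m hp (V ⊗ Y) U hVY hU hVU
  have r := m.right hV hY hVY
  calc _ = 𝟙 _ ⊗≫ dual V ◁ push A (V ⊗ Y) U hVU ⊗≫ (ev V ▷ (Y ⊗ (dual U ⊗ (A.obj ⊗ U))) ≫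
        𝟙_ C ◁ (Y ◁ absorb (m.map U hU))) ⊗≫ 𝟙 _ := by unfold pass; monoidal
    _ = 𝟙 _ ⊗≫ dual V ◁ (push A (V ⊗ Y) U hVU ≫ (V ⊗ Y) ◁ absorb (m.map U hU)) ⊗≫
        ev V ▷ (Y ⊗ B.obj) ⊗≫ 𝟙 _ := by
        rw [← whisker_exchange]; monoidal
    _ = scal (dimL U) (𝟙 _ ⊗≫ dual V ◁ m.map (V ⊗ Y) hVY ⊗≫
        ev V ▷ (Y ⊗ B.obj) ⊗≫ 𝟙 _) := by
        rw [p]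
        simp only [hp.whiskerLeft_scal, scal_monoidalComp, monoidalComp_scal]
    _ = scal (dimL U) (𝟙 _ ⊗≫ dual V ◁ ((α_ _ _ _).hom ≫ m.map (V ⊗ Y) hVY ≫ (α_ _ _ _).hom)
        ⊗≫ ev V ▷ (Y ⊗ B.obj) ⊗≫ 𝟙 _) := by
        congr 1; monoidal
    _ = scal (dimL U) (𝟙 _ ⊗≫ (dual V ◁ m.map V hV) ▷ Y ⊗≫
        ((dual V ⊗ V) ◁ (B.braid Y hY).hom ≫ ev V ▷ (Y ⊗ B.obj)) ⊗≫ 𝟙 _) := by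
        rw [← r]; congr 1; monoidal
    _ = _ := by
        rw [whisker_exchange]; congr 1; unfold absorb; monoidal

theorem pass₀_absorb (hp : IsPure C) (V U : C) (hV : D.deg β V) (hU : D.deg β U)
    (hVU : D.deg 1 (V ⊗ dual U)) :
    pass₀ A V U hVU ≫ absorb (m.map U hU) = scal (dimL U) (absorb (m.map V hV)) := by
  have hVU' : D.deg 1 ((V ⊗ 𝟙_ C) ⊗ dual U) :=
    D.mem_tensor_dual (D.mem_tensor_one hV D.unit_mem) hU
  have p := pass_absorb m hp V (𝟙_ C) U hV hU D.unit_mem hVU'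
  rw [pass_unit A V U hVU' hVU,
    B.braid_unit D.unit_mem (D.mem_tensor_one D.unit_mem D.unit_mem)] at p
  calc _ = (ρ_ _).inv ≫ (((ρ_ _).hom ≫ pass₀ A V U hVU ≫ (λ_ _).inv) ≫
        𝟙_ C ◁ absorb (m.map U hU)) ≫ (λ_ _).hom := by monoidal
    _ = _ := by
      rw [p]
      simp only [scal_comp, comp_scal]
      congr 1
      monoidal

variable (S : Splittings D)

/-- The morphism `d_V⁻¹ (ev_V ⊗ B) (V^* ⊗ m_V) q^V : φ_V(A) ⟶ B`. -/
def Intertwiner.toHom (hp : IsPure C) (V : InvObj D β) : (phi S hp V).obj A ⟶ B where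
  hom := (S β V A).q ≫ scal V.invDim (absorb (m.map V.obj V.mem))
  comm Y hY := by
    have p := pass_absorb m hp V.obj Y V.obj V.mem V.mem hY (mem_mid V.mem hY V.mem)
    have c := pass_pi hp V V A Y hY
    have e : ((S β V A).q ≫ scal V.invDim (absorb (m.map V.obj V.mem))) ▷ Y ≫
        (B.braid Y hY).hom = scal V.invDim (mid S V V A Y hY) ≫
        Y ◁ ((S β V A).q ≫ scal V.invDim (absorb (m.map V.obj V.mem))) := by
      calc _ = scal V.invDim ((S β V A).q ▷ Y ≫ absorb (m.map V.obj V.mem) ▷ Y ≫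
            (B.braid Y hY).hom) := by
            rw [comp_scal, scal_whiskerRight, scal_comp, comp_whiskerRight, Category.assoc]
        _ = scal V.invDim (scal V.invDim ((S β V A).q ▷ Y ≫
            pass A V.obj Y V.obj (mem_mid V.mem hY V.mem) ≫
            Y ◁ absorb (m.map V.obj V.mem))) := by
            rw [p, comp_scal, scal_scal V.invDim (dimL _), V.invDim_dim, scal_one]
        _ = scal V.invDim (scal V.invDim ((S β V A).q ▷ Y ≫
            (pass A V.obj Y V.obj (mem_mid V.mem hY V.mem) ≫ Y ◁ piV V A) ≫
            Y ◁ absorb (m.map V.obj V.mem))) := by rw [c]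
        _ = _ := by
            rw [comp_scal, hp.whiskerLeft_scal, comp_scal, scal_comp]
            unfold mid
            simp only [Category.assoc, ← MonoidalCategory.whiskerLeft_comp,
              reassoc_of% (S β V A).p_q]
    exact e

theorem Intertwiner.delta_toHom (hp : IsPure C) (U V : InvObj D β) :
    scal V.invDim (delta₀ S V U A) ≫ (S β U A).q ≫ scal U.invDim (absorb (m.map U.obj U.mem)) =
      (S β V A).q ≫ scal V.invDim (absorb (m.map V.obj V.mem)) := by
  have p := pass₀_absorb m hp V.obj U.obj V.mem U.mem (D.mem_tensor_dual V.mem U.mem)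
  have p' := pass₀_absorb m hp U.obj U.obj U.mem U.mem (D.mem_tensor_dual U.mem U.mem)
  have c : piV U A ≫ absorb (m.map U.obj U.mem) = absorb (m.map U.obj U.mem) := by
    rw [piV, scal_comp, p', scal_scal, U.invDim_dim, scal_one]
  calc _ = scal V.invDim (scal U.invDim ((S β V A).q ≫
        pass₀ A V.obj U.obj (D.mem_tensor_dual V.mem U.mem) ≫ ((S β U A).p ≫ (S β U A).q) ≫
        absorb (m.map U.obj U.mem))) := by
        unfold delta₀
        simp only [comp_scal, scal_comp, Category.assoc]
        rw [scal_comm]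
    _ = _ := by
        rw [(S β U A).p_q, c, p, comp_scal, scal_scal U.invDim, U.invDim_dim, scal_one, comp_scal]

theorem Intertwiner.Gam_toHom (hp : IsPure C) (V : InvObj D β) (W : C) (hW : D.deg β W) :
    Gam S V A W hW ≫ W ◁ ((S β V A).q ≫ scal V.invDim (absorb (m.map V.obj V.mem))) =
      m.map W hW := by
  have p := push_absorb m hp W V.obj hW V.mem (D.mem_tensor_dual hW V.mem)
  have p' := pass₀_absorb m hp V.obj V.obj V.mem V.mem (D.mem_tensor_dual V.mem V.mem)
  have c : piV V A ≫ absorb (m.map V.obj V.mem) = absorb (m.map V.obj V.mem) := by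
    rw [piV, scal_comp, p', scal_scal, V.invDim_dim, scal_one]
  calc _ = scal V.invDim (push A W V.obj (D.mem_tensor_dual hW V.mem) ≫
        W ◁ (((S β V A).p ≫ (S β V A).q) ≫ absorb (m.map V.obj V.mem))) := by
        unfold Gam
        simp only [comp_scal, hp.whiskerLeft_scal, Category.assoc,
          MonoidalCategory.whiskerLeft_comp]
    _ = _ := by
        rw [(S β V A).p_q, c, p, scal_scal, V.invDim_dim, scal_one]

end Intertwiner

/-- The family `(W ⊗ Z_2(β,α)_X) ∂^β_{Z_α(X),W}`. -/
def freeIntertwiner {α β γ : G} (h : α * β = γ) (X : C) :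
    Intertwiner (free Z α X) (free Z γ X) β where
  map W hW := (Z β).part ((Z α).obj X) W hW ≫ W ◁ Z2 Z h X
  natural {W W'} hW hW' f := by
    have e := mix_natural Z h X hW hW' f
    simp only [← part_Z2] at e
    exact e
  left {Y W} hY hW hYW := by
    have e := mix_mix Z (mul_one α) h h X hY hW hYW
    simp only [← part_Z2] at e
    exact e
  right {W Y} hW hY hWY := by
    have e := mix_mix Z h (mul_one γ) h X hW hY hWY
    simp only [← part_Z2] at e
    exact e

/-- The morphism `ω^{V}_X : φ_V(F_α(X)) ⟶ F_γ(X)` in the `G`-center, where `V ∈ E_β` and `γ = αβ`: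
it is the composition of `q^V` with
`a^V_X = d_V⁻¹ (ev_V ⊗ id) (V^* ⊗ (V ⊗ Z_2(β,α)_X) ∂^β_{Z_α(X),V})`. -/
def omegaV (S : Splittings D) (hp : IsPure C) {α β γ : G} (h : α * β = γ) (X : C)
    (V : InvObj D β) : (phi S hp V).obj (free Z α X) ⟶ free Z γ X where
  hom := (S β V (free Z α X)).q ≫ scal V.invDim
    (absorb ((Z β).part ((Z α).obj X) V.obj V.mem ≫ V.obj ◁ Z2 Z h X))
  comm := ((freeIntertwiner Z h X).toHom S hp V).comm

variable {S : Splittings D} {hp : IsPure C}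

theorem existsUnique_lift_left {K : Type*} [Category K] {I : Type*} {E B : K} (F : I → K)
    (leg : ∀ V, E ⟶ F V)
    (d : ∀ V U, F V ⟶ F U) (hd : ∀ V U, leg V ≫ d V U = leg U)
    (g : ∀ V, F V ⟶ B) (hg : ∀ V U, d V U ≫ g U = g V) (hI : Nonempty I) :
    ∃! t : E ⟶ B, ∀ V, leg V ≫ g V = t := by
  obtain ⟨V⟩ := hI
  refine ⟨leg V ≫ g V, fun U => ?_, fun t ht => (ht V).symm⟩
  rw [← hd V U, Category.assoc, hg]

theorem existsUnique_omega (hn : NonSingular D) (L : Crossing S hp) {α β γ : G}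
    (h : α * β = γ) (X : C) :
    ∃! w : (L.functor β).obj (free Z α X) ⟶ free Z γ X,
      ∀ V : InvObj D β, (L.ι V).app (free Z α X) ≫ omegaV Z S hp h X V = w := by
  refine existsUnique_lift_left (fun V : InvObj D β => (phi S hp V).obj (free Z α X))
    (fun V => (L.ι V).app _) (fun V U => (delta S hp U V).app (free Z α X))
    (fun V U => ?_) (fun V => omegaV Z S hp h X V) (fun V U => ?_) (hn.exists_inv β)
  · rw [← L.ι_delta U V]; rfl
  · apply RelCenter.hom_ext
    exact (freeIntertwiner Z h X).delta_toHom S hp U V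

/-- The morphism `ω^{β,α}_X : φ_β(F_α(X)) ⟶ F_γ(X)` in the `G`-center, where `γ = αβ`: the unique
one such that `ω^{β,α}_X = ω^V_X ∘ (ι^β_V)_{F_α(X)}` for all `V ∈ E_β`. -/
def omega (hn : NonSingular D) (L : Crossing S hp) {α β γ : G} (h : α * β = γ) (X : C) :
    (L.functor β).obj (free Z α X) ⟶ free Z γ X :=
  (existsUnique_omega Z hn L h X).choose

theorem ι_omegaV (hn : NonSingular D) (L : Crossing S hp) {α β γ : G} (h : α * β = γ) (X : C)
    (V : InvObj D β) :
    (L.ι V).app (free Z α X) ≫ omegaV Z S hp h X V = omega Z hn L h X :=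
  (existsUnique_omega Z hn L h X).choose_spec.1 V

end Free

end

end GCat

namespace GCat

noncomputable section

section Fusion

variable (k : Type*) [CommRing k] {G : Type w} [Group G] {C : Type u} [Category.{v} C]
  [MonoidalCategory C] [PivotalCategory C] [Preadditive C] [Linear k C] [HasFiniteBiproducts C]

/-- An object is simple if its endomorphism module is free of rank `1` over `k`. -/
def IsSimpleObj (X : C) : Prop := Nonempty (k ≃ₗ[k] (X ⟶ X))

/-- A `G`-graded pivotal category is `G`-fusion (over `k`) if its unit object is simple, it is split
semisimple, i.e. every object is a finite direct sum of simple objects and there are no non-zero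
morphisms between non-isomorphic simple objects, and, for every `α`, the category `C_α` has at least
one and, up to isomorphism, only finitely many simple objects. -/
structure IsGFusion (D : PivotalGrading G C) : Prop where
  unit_simple : IsSimpleObj k (𝟙_ C)
  exists_decomposition (X : C) : ∃ (n : ℕ) (f : Fin n → C),
    (∀ m, IsSimpleObj k (f m)) ∧ Nonempty (X ≅ ⨁ f)
  hom_eq_zero (i j : C) : IsSimpleObj k i → IsSimpleObj k j → ¬ Nonempty (i ≅ j) →
    ∀ f : i ⟶ j, f = 0
  exists_simple (α : G) : ∃ i : C, D.deg α i ∧ IsSimpleObj k i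
  finite_simple (α : G) : ∃ s : Finset C, ∀ i : C, D.deg α i → IsSimpleObj k i →
    ∃ j ∈ s, Nonempty (i ≅ j)

/-- A `G`-representative set of simple objects: its elements are simple and homogeneous, and every
simple object is isomorphic to a unique element of it. -/
structure IsGRepresentative (D : PivotalGrading G C) (I : Set C) : Prop where
  simple : ∀ i ∈ I, IsSimpleObj k i
  homogeneous : ∀ i ∈ I, ∃ α : G, D.deg α i
  existsUnique : ∀ j : C, IsSimpleObj k j → ∃! i : C, i ∈ I ∧ Nonempty (j ≅ i)

/-- The set `I_α` of elements of `I` belonging to `C_α`. -/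
def Component (D : PivotalGrading G C) (I : Set C) (α : G) : Type u :=
  {i : C // i ∈ I ∧ D.deg α i}

variable {k}

theorem finite_component {D : PivotalGrading G C} {I : Set C} (hF : IsGFusion k D)
    (hI : IsGRepresentative k D I) (α : G) : Finite (Component D I α) := by
  obtain ⟨s, hs⟩ := hF.finite_simple α
  choose f hf hf' using fun i : Component D I α => hs i.1 i.2.2 (hI.simple _ i.2.1)
  refine Finite.of_injective (fun i => (⟨f i, hf i⟩ : s)) fun i j hij => ?_
  have e : f i = f j := congrArg Subtype.val hij
  obtain ⟨a⟩ := hf' i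
  obtain ⟨b⟩ := hf' j
  obtain ⟨l, -, hl⟩ := hI.existsUnique i.1 (hI.simple _ i.2.1)
  have h1 : i.1 = l := hl i.1 ⟨i.2.1, ⟨Iso.refl _⟩⟩
  have h2 : j.1 = l := hl j.1 ⟨j.2.1, ⟨a ≪≫ eqToIso e ≪≫ b.symm⟩⟩
  exact Subtype.ext (h1.trans h2.symm)

/-- The finite set `I_α`, as a `Fintype`. -/
@[reducible]
def componentFintype {D : PivotalGrading G C} {I : Set C} (hF : IsGFusion k D)
    (hI : IsGRepresentative k D I) (α : G) : Fintype (Component D I α) :=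
  have := finite_component hF hI α
  Fintype.ofFinite _

/-- Morphisms `ρ_i : F_i ⟶ T` and `π_i : T ⟶ F_i` which exhibit `T` as the direct sum of the finite
family `F`. -/
structure IsDirectSum {J : Type*} [Fintype J] {F : J → C} {T : C} (ρ : ∀ i, F i ⟶ T)
    (π : ∀ i, T ⟶ F i) : Prop where
  ρ_π (i : J) : ρ i ≫ π i = 𝟙 (F i)
  ρ_π_ne (i j : J) : i ≠ j → ρ i ≫ π j = 0
  sum : ∑ i, π i ≫ ρ i = 𝟙 T

/-- An `I_α`-partition of `T`: a decomposition of `T` as a direct sum of a finite family of objects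
belonging to `I_α`. -/
structure Partition (D : PivotalGrading G C) (I : Set C) (α : G) (T : C) where
  n : ℕ
  idx : Fin n → Component D I α
  p (l : Fin n) : T ⟶ (idx l).1
  q (l : Fin n) : (idx l).1 ⟶ T
  isDirectSum : IsDirectSum q p

/-- For `p : i ⊗ Y ⟶ j` and `q : j ⟶ i ⊗ Y`, the morphism
`i^* ⊗ X ⊗ i ⊗ Y ⟶ Y ⊗ j^* ⊗ X ⊗ j` given by
`((ev_i ⊗ Y ⊗ j^*) (i^* ⊗ q ⊗ j^*) (i^* ⊗ coev_j)) ⊗ X ⊗ p`. -/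
def braidTerm (X : C) {i j Y : C} (p : i ⊗ Y ⟶ j) (q : j ⟶ i ⊗ Y) :
    (dual i ⊗ (X ⊗ i)) ⊗ Y ⟶ Y ⊗ (dual j ⊗ (X ⊗ j)) :=
  𝟙 _ ⊗≫ (dual i ◁ coev j ⊗≫ dual i ◁ (q ▷ dual j) ⊗≫ ev i ▷ (Y ⊗ dual j)) ▷ (X ⊗ (i ⊗ Y)) ⊗≫
    (Y ⊗ dual j) ◁ (X ◁ p) ⊗≫ 𝟙 _

end Fusion

end

end GCat

open GCat

namespace GCat

noncomputable section

/-! ### Comparison of splittings, and joint epimorphy of the family ∂ -/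

section General

variable {C : Type u} [Category.{v} C]

/-! Write γ = αβ. Everything goes through `mix`, the morphism (id_Y ⊗ Z_2) ∂^β : Z_α(X) ⊗ Y → Y ⊗
Z_γ(X). As Y varies these morphisms are natural and compatible with the half-braidings of the free
objects, so `Intertwiner.Gam_toHom` already says that τ followed by id_Y ⊗ ω is `mix` (`tau_omega`).
The formula for τ follows once ω is invertible.

For invertibility, fix V ∈ E_β. Up to the invertible ι_V and the inclusion q^V, ω is the map a : V^*
⊗ Z_α(X) ⊗ V → Z_γ(X) given by d_V⁻¹ times `absorb` of `mix`. The point is that a is the projection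
of a second splitting of the idempotent π^V. Its inclusion is `emit`, which the coend Z_γ(X)
provides from the morphisms that insert V^* ⊗ V after W and apply ∂^α at W ⊗ V^*, an object of
degree γβ⁻¹ = α. Going from Z_γ(X) and back closes V into a loop, of value d_V (`emit_absorb`). The
other composite carries V ⊗ V^* across Z_α(X) by the half-braiding of the free object, which is d_V
π^V (`absorb_emit`, `piV_free`). Two splittings of one idempotent are canonically isomorphic, so q^V
followed by a is invertible (`Splitting.isIso_q_comp`, `isIso_omegaV`).

In the fusion case every object of C_δ is a direct sum of elements of I_δ
(`IsGFusion.nonempty_partition`), so a morphism out of Z_δ(X) is determined by its composites with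
ρ_i for i ∈ I_δ (`rho_ext`). These composites can be prescribed at will, because the only morphisms
between elements of I_δ are zero and scalar multiples of identities, for which dinaturality is
automatic (`exists_rho_comp_eq`). This is the universal property of a direct sum. Restricted to the
summand i^* ⊗ X ⊗ i, `mix` is ∂^γ at i ⊗ Y with i evaluated (`rho_whiskerRight_mix`). Cutting i ⊗ Y
into simple summands splits ∂^γ by naturality (`Partition.part_eq`), and each piece is Θ followed by
a ρ_j (`braidTerm_rho`). -/

theorem Splitting.isIso_q_comp {T B : C} {e : T ⟶ T} (s : Splitting e) (a : T ⟶ B) (b : B ⟶ T)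
    (h : a ≫ b = e) (h' : b ≫ a = 𝟙 B) : IsIso (s.q ≫ a) := by
  refine ⟨b ≫ s.p, ?_, ?_⟩
  · rw [Category.assoc, reassoc_of% h, s.q_e_p]
  · rw [Category.assoc, reassoc_of% s.p_q, ← h, Category.assoc, h', Category.comp_id, h']

theorem RelCenter.eq_comp_whiskerLeft_inv [MonoidalCategory C] {P : ObjectProperty C}
    {A B : RelCenter P} (w : A ⟶ B) [IsIso w] {T Y : C} {t : T ⟶ Y ⊗ A.obj} {m : T ⟶ Y ⊗ B.obj}
    (h : t ≫ Y ◁ w.hom = m) :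
    t = m ≫ Y ◁ (inv w).hom := by
  rw [← h, Category.assoc, ← MonoidalCategory.whiskerLeft_comp,
    ← RelCenter.comp_hom, IsIso.hom_inv_id, RelCenter.id_hom, MonoidalCategory.whiskerLeft_id,
    Category.comp_id]

namespace Centralizer

variable [MonoidalCategory C] [PivotalCategory C] {P : ObjectProperty C} (Z : Centralizer P)

theorem part_comp_natural (X : C) {B W W' : C} (hW : P W) (hW' : P W') (f : W ⟶ W')
    (r : Z.obj X ⟶ B) :
    X ◁ f ≫ Z.part X W' hW' ≫ W' ◁ r = (Z.part X W hW ≫ W ◁ r) ≫ f ▷ B := by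
  rw [← Category.assoc, Z.part_natural X hW hW' f, Category.assoc, Category.assoc,
    whisker_exchange]

/-- Uniqueness in the universal property of the coend, transported from ρ to ∂ by duality. -/
theorem part_ext {X B : C} {r r' : Z.obj X ⟶ B}
    (h : ∀ (W : C) (hW : P W), Z.part X W hW ≫ W ◁ r = Z.part X W hW ≫ W ◁ r') :
    r = r' :=
  (Z.existsUnique X B (fun W hW => Z.part X W hW ≫ W ◁ r')
    (fun _ _ hW hW' f => Z.part_comp_natural X hW hW' f r')).unique h (fun _ _ => rfl)

end Centralizer

end General

/-! ### Invertibility of ω and the value of τ on free objects -/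

section FreeCrossing

variable {G : Type w} [Group G] {C : Type u} [Category.{v} C] [MonoidalCategory C]
  [PivotalCategory C] [Preadditive C] [HasFiniteBiproducts C] {D : PivotalGrading G C}

theorem PivotalGrading.mem_tensor_dual_eq (D : PivotalGrading G C) {α β γ : G} (h : α * β = γ)
    {W V : C} (hW : D.deg γ W) (hV : D.deg β V) : D.deg α (W ⊗ dual V) :=
  D.mem_cast (D.tensor_mem hW (D.dual_mem hV)) (by rw [← h, mul_inv_cancel_right])

variable (Z : ∀ α : G, Centralizer (D.deg α))

/-- The right-hand family is natural in W: f : W ⟶ W' slides past the inserted `coevt V`, and ∂^α is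
natural along f ⊗ V^*. The coend Z_γ(X) therefore turns it into one morphism. -/
theorem existsUnique_emit {α β γ : G} (h : α * β = γ) (X V : C) (hV : D.deg β V) :
    ∃! r : (Z γ).obj X ⟶ dual V ⊗ ((Z α).obj X ⊗ V), ∀ (W : C) (hW : D.deg γ W),
      (Z γ).part X W hW ≫ W ◁ r = 𝟙 _ ⊗≫ (X ⊗ W) ◁ coevt V ⊗≫
        (Z α).part X (W ⊗ dual V) (D.mem_tensor_dual_eq h hW hV) ▷ V ⊗≫ 𝟙 _ :=
  (Z γ).existsUnique X _
    (fun W hW => 𝟙 _ ⊗≫ (X ⊗ W) ◁ coevt V ⊗≫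
        (Z α).part X (W ⊗ dual V) (D.mem_tensor_dual_eq h hW hV) ▷ V ⊗≫ 𝟙 _)
    (fun W W' hW hW' f => by
      have n := (Z α).part_natural X (D.mem_tensor_dual_eq h hW hV)
        (D.mem_tensor_dual_eq h hW' hV) (f ▷ dual V)
      calc _ = 𝟙 _ ⊗≫ ((X ◁ f) ▷ 𝟙_ C ≫ (X ⊗ W') ◁ coevt V) ⊗≫
            (Z α).part X (W' ⊗ dual V) (D.mem_tensor_dual_eq h hW' hV) ▷ V ⊗≫ 𝟙 _ := by monoidal
        _ = 𝟙 _ ⊗≫ (X ⊗ W) ◁ coevt V ⊗≫ (X ◁ (f ▷ dual V) ≫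
            (Z α).part X (W' ⊗ dual V) (D.mem_tensor_dual_eq h hW' hV)) ▷ V ⊗≫ 𝟙 _ := by
          rw [← whisker_exchange]; monoidal
        _ = _ := by rw [n]; monoidal)

/-- The morphism `Z_γ(X) ⟶ V^* ⊗ Z_α(X) ⊗ V` induced by the family
`(∂^α_{X,W ⊗ V^*} ⊗ V) (X ⊗ W ⊗ coevt_V)`, where `γ = αβ` and `V ∈ C_β`. -/
def emit {α β γ : G} (h : α * β = γ) (X V : C) (hV : D.deg β V) :
    (Z γ).obj X ⟶ dual V ⊗ ((Z α).obj X ⊗ V) :=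
  (existsUnique_emit Z h X V hV).choose

theorem part_emit {α β γ : G} (h : α * β = γ) (X V : C) (hV : D.deg β V) (W : C)
    (hW : D.deg γ W) :
    (Z γ).part X W hW ≫ W ◁ emit Z h X V hV = 𝟙 _ ⊗≫ (X ⊗ W) ◁ coevt V ⊗≫
        (Z α).part X (W ⊗ dual V) (D.mem_tensor_dual_eq h hW hV) ▷ V ⊗≫ 𝟙 _ :=
  (existsUnique_emit Z h X V hV).choose_spec.1 W hW

/-- Tested against ∂^γ at W, the composite is ∂^γ at (W ⊗ V^*) ⊗ V with V^* ⊗ V created by `coevt V`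
and removed by `ev V`. What remains is a closed loop coloured by V. -/
theorem emit_absorb (hp : IsPure C) {α β γ : G} (h : α * β = γ) (X V : C) (hV : D.deg β V) :
    emit Z h X V hV ≫ absorb (mix Z h X V hV) = scal (dimL V) (𝟙 _) := by
  refine (Z γ).part_ext fun W hW => ?_
  have hWV := D.mem_tensor_dual_eq h hW hV
  -- Naturality of ∂^γ along this contraction moves the evaluation before ∂^γ, where it meets `coevt
  -- V`.
  let f : (W ⊗ dual V) ⊗ V ⟶ W := (α_ _ _ _).hom ≫ W ◁ ev V ≫ (ρ_ _).hom
  have n := (Z γ).part_natural X (D.mem_tensor_eq h hWV hV) hW f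
  have s := mix_spec Z h X V hV (W ⊗ dual V) hWV
  calc _ = ((Z γ).part X W hW ≫ W ◁ emit Z h X V hV) ≫ W ◁ absorb (mix Z h X V hV) := by simp
    _ = 𝟙 _ ⊗≫ (X ⊗ W) ◁ coevt V ⊗≫ ((Z α).part X (W ⊗ dual V) hWV ▷ V ≫ (α_ _ _ _).hom ≫
        (W ⊗ dual V) ◁ mix Z h X V hV) ⊗≫ W ◁ (ev V ▷ (Z γ).obj X) ⊗≫ 𝟙 _ := by
        rw [part_emit]; unfold absorb; monoidal
    _ = 𝟙 _ ⊗≫ (X ⊗ W) ◁ coevt V ⊗≫ ((Z γ).part X ((W ⊗ dual V) ⊗ V)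
        (D.mem_tensor_eq h hWV hV) ≫ f ▷ _) ⊗≫ 𝟙 _ := by
        rw [s]; simp only [f]; monoidal
    _ = 𝟙 _ ⊗≫ X ◁ (W ◁ (coevt V ≫ ev V)) ⊗≫ (Z γ).part X W hW := by
        rw [← n]; simp only [f]; monoidal
    -- The loop is written as a whiskered scalar so that `whiskerRight_eq_scal` applies; purity then
    -- moves it out past X and W.
    _ = 𝟙 _ ⊗≫ X ◁ (W ◁ (dimL V ▷ 𝟙_ C)) ⊗≫ (Z γ).part X W hW := by
        simp only [dimL]; monoidal
    _ = _ := by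
        rw [whiskerRight_eq_scal]
        simp only [hp.whiskerLeft_scal, scal_monoidalComp, monoidalComp_scal, comp_scal]
        congr 1
        monoidal

/-- The morphism `(s ⊗ U) (A ⊗ W ⊗ coevt_U)`. -/
def pushOf {A : C} (W U : C) (s : A ⊗ (W ⊗ dual U) ⟶ (W ⊗ dual U) ⊗ A) :
    A ⊗ W ⟶ W ⊗ (dual U ⊗ (A ⊗ U)) :=
  𝟙 _ ⊗≫ (A ⊗ W) ◁ coevt U ⊗≫ s ▷ U ⊗≫ 𝟙 _

/-- The morphism obtained from `pushOf V U s` by evaluating `V`. -/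
def passOf {A : C} (V U : C) (s : A ⊗ (V ⊗ dual U) ⟶ (V ⊗ dual U) ⊗ A) :
    dual V ⊗ (A ⊗ V) ⟶ dual U ⊗ (A ⊗ U) :=
  𝟙 _ ⊗≫ dual V ◁ pushOf V U s ⊗≫ ev V ▷ (dual U ⊗ (A ⊗ U)) ⊗≫ 𝟙 _

/-- Tested against ∂^α at W, both sides are ∂^α at W ⊗ V ⊗ V^* with `coevt V` inserted. On the right
this is the defining relation of `mix` at V ⊗ V^*, which has degree 1, so that the half-braiding of
the free object appears. -/
theorem mix_emit {α β γ : G} (h : α * β = γ) (X V : C) (hV : D.deg β V)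
    (hVV : D.deg 1 (V ⊗ dual V)) :
    mix Z h X V hV ≫ V ◁ emit Z h X V hV =
      pushOf V V (mix Z (mul_one α) X (V ⊗ dual V) hVV) := by
  unfold pushOf
  refine (Z α).param_ext fun W hW => ?_
  have hWV := D.mem_tensor_eq h hW hV
  have s := mix_spec Z h X V hV W hW
  have s' := mix_spec Z (mul_one α) X (V ⊗ dual V) hVV W hW
  -- `part_emit` brackets the object as (W ⊗ V) ⊗ V^*, while `mix_spec` needs W ⊗ (V ⊗ V^*);
  -- naturality of ∂^α along the associator relates the two.
  have n := (Z α).part_natural X (D.mem_tensor_dual_eq h hWV hV)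
    (D.mem_tensor_eq (mul_one α) hW hVV) (α_ W V (dual V)).hom
  calc _ = ((Z α).part X W hW ▷ V ≫ (α_ _ _ _).hom ≫ W ◁ mix Z h X V hV) ≫
        W ◁ (V ◁ emit Z h X V hV) := by monoidal
    _ = (α_ _ _ _).hom ≫ ((Z γ).part X (W ⊗ V) hWV ≫ (W ⊗ V) ◁ emit Z h X V hV) ≫
        (α_ _ _ _).hom := by rw [s]; monoidal
    _ = 𝟙 _ ⊗≫ (X ⊗ (W ⊗ V)) ◁ coevt V ⊗≫
        ((Z α).part X ((W ⊗ V) ⊗ dual V) (D.mem_tensor_dual_eq h hWV hV) ≫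
          (α_ W V (dual V)).hom ▷ _) ▷ V ⊗≫ 𝟙 _ := by rw [part_emit]; monoidal
    _ = 𝟙 _ ⊗≫ ((X ⊗ W) ⊗ V) ◁ coevt V ⊗≫ ((α_ _ _ _).hom ≫
        (Z α).part X (W ⊗ (V ⊗ dual V)) (D.mem_tensor_eq (mul_one α) hW hVV) ≫
          (α_ _ _ _).hom) ▷ V ⊗≫ 𝟙 _ := by rw [← n]; monoidal
    _ = 𝟙 _ ⊗≫ (((X ⊗ W) ⊗ V) ◁ coevt V ≫ (Z α).part X W hW ▷ V ▷ (dual V ⊗ V)) ⊗≫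
        W ◁ (mix Z (mul_one α) X (V ⊗ dual V) hVV ▷ V) ⊗≫ 𝟙 _ := by rw [← s']; monoidal
    _ = _ := by rw [whisker_exchange]; monoidal

/-- This is `mix_emit` with V evaluated: `ev V` and `emit` act on disjoint factors, so they can be
interchanged. The right-hand side is d_V π^V for the free object. -/
theorem absorb_emit {α β γ : G} (h : α * β = γ) (X V : C) (hV : D.deg β V)
    (hVV : D.deg 1 (V ⊗ dual V)) :
    absorb (mix Z h X V hV) ≫ emit Z h X V hV =
      passOf V V (mix Z (mul_one α) X (V ⊗ dual V) hVV) := by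
  calc _ = dual V ◁ mix Z h X V hV ⊗≫ (ev V ▷ (Z γ).obj X ≫ 𝟙_ C ◁ emit Z h X V hV) ⊗≫ 𝟙 _ := by
        unfold absorb; monoidal
    _ = 𝟙 _ ⊗≫ dual V ◁ (mix Z h X V hV ≫ V ◁ emit Z h X V hV) ⊗≫
        ev V ▷ (dual V ⊗ ((Z α).obj X ⊗ V)) ⊗≫ 𝟙 _ := by
        rw [← whisker_exchange]; monoidal
    _ = _ := by rw [mix_emit Z h X V hV hVV]; rfl

/-- Since ρ is ∂ with W evaluated, this is the defining relation of `mix` with W evaluated. It gives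
the components of `mix` on the summands in the fusion case. -/
theorem rho_whiskerRight_mix {α β γ : G} (h : α * β = γ) (X Y : C) (hY : D.deg β Y) (W : C)
    (hW : D.deg α W) :
    (Z α).rho X W hW ▷ Y ≫ mix Z h X Y hY =
      𝟙 _ ⊗≫ dual W ◁ (Z γ).part X (W ⊗ Y) (D.mem_tensor_eq h hW hY) ⊗≫
        ev W ▷ (Y ⊗ (Z γ).obj X) ⊗≫ 𝟙 _ := by
  have s := mix_spec Z h X Y hY W hW
  calc _ = 𝟙 _ ⊗≫ dual W ◁ ((Z α).part X W hW ▷ Y) ⊗≫ (ev W ▷ ((Z α).obj X ⊗ Y) ≫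
        𝟙_ C ◁ mix Z h X Y hY) ⊗≫ 𝟙 _ := by rw [(Z α).rho_eq]; monoidal
    _ = 𝟙 _ ⊗≫ dual W ◁ ((Z α).part X W hW ▷ Y ≫ (α_ _ _ _).hom ≫ W ◁ mix Z h X Y hY) ⊗≫
        ev W ▷ (Y ⊗ (Z γ).obj X) ⊗≫ 𝟙 _ := by rw [← whisker_exchange]; monoidal
    _ = _ := by rw [s]; monoidal

variable {S : Splittings D} {hp : IsPure C}

/-- `piV` sees its object only through the half-braiding at V ⊗ V^*, and `passOf` is `pass₀` with
that half-braiding as an argument. It thus suffices to substitute the half-braiding of the free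
object, which is `mix`. -/
theorem piV_free (α : G) {β : G} (X : C) (V : InvObj D β) :
    piV V (free Z α X) = scal V.invDim (passOf V.obj V.obj (mix Z (mul_one α) X
      (V.obj ⊗ dual V.obj) (D.mem_tensor_dual V.mem V.mem))) :=
  congrArg (fun s => scal V.invDim (passOf V.obj V.obj s))
    (free_braid Z α X _ (D.mem_tensor_dual V.mem V.mem))

/-- The pair formed by d_V⁻¹ `absorb` and `emit` splits the same idempotent as p^V, q^V.
Invertibility in C is enough, since inverses of morphisms of the center are again in the center. -/
theorem isIso_omegaV {α β γ : G} (h : α * β = γ) (X : C) (V : InvObj D β) :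
    IsIso (omegaV Z S hp h X V) := by
  apply RelCenter.isIso_of_hom
  have e : scal V.invDim (absorb (mix Z h X V.obj V.mem)) ≫ emit Z h X V.obj V.mem =
      scal V.invDim (passOf V.obj V.obj (mix Z (mul_one α) X
        (V.obj ⊗ dual V.obj) (D.mem_tensor_dual V.mem V.mem))) := by
    rw [scal_comp, absorb_emit]
  have e' : emit Z h X V.obj V.mem ≫ scal V.invDim (absorb (mix Z h X V.obj V.mem)) = 𝟙 _ := by
    rw [comp_scal, emit_absorb Z hp, scal_scal, V.invDim_dim, scal_one]
  -- `omegaV` is stated with ∂ followed by `Z2`, so the absorbed `mix` is put back in that form.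
  rw [← part_Z2] at e e'
  exact (S β V (free Z α X)).isIso_q_comp _ _ (e.trans (piV_free Z α X V).symm) e'

theorem isIso_omega (hn : NonSingular D) (L : Crossing S hp) {α β γ : G} (h : α * β = γ) (X : C) :
    IsIso (omega Z hn L h X) := by
  obtain ⟨V⟩ := hn.exists_inv β
  have := isIso_omegaV Z (S := S) (hp := hp) h X V
  have := L.isIso_ι V
  rw [← ι_omegaV Z hn L h X V]
  infer_instance

/-- Any single V ∈ E_β suffices: ω factors through ι_V, τ followed by ι_V is Γ^V, and Γ^V followed
by the morphism induced by an intertwiner gives back the intertwiner. -/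
theorem tau_omega (hn : NonSingular D) (L : Crossing S hp) {α β γ : G} (h : α * β = γ) (X Y : C)
    (hY : D.deg β Y) :
    tau hn L (free Z α X) Y hY ≫ Y ◁ (omega Z hn L h X).hom = mix Z h X Y hY := by
  obtain ⟨V⟩ := hn.exists_inv β
  have g := (freeIntertwiner Z h X).Gam_toHom S hp V Y hY
  rw [← ι_omegaV Z hn L h X V, RelCenter.comp_hom, MonoidalCategory.whiskerLeft_comp,
    ← Category.assoc, tau_ι, ← part_Z2]
  exact g

theorem tau_free (hn : NonSingular D) (L : Crossing S hp) {α β γ : G} (h : α * β = γ) (X Y : C)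
    (hY : D.deg β Y) [IsIso (omega Z hn L h X)] :
    tau hn L (free Z α X) Y hY = mix Z h X Y hY ≫ Y ◁ (inv (omega Z hn L h X)).hom := 
  RelCenter.eq_comp_whiskerLeft_inv _ (tau_omega Z hn L h X Y hY)

end FreeCrossing

/-! ### Families X ⊗ Y ⟶ Y ⊗ B assembled from direct summands of Y -/

section Sums

variable {C : Type u} [Category.{v} C] [MonoidalCategory C] [Preadditive C]
  [MonoidalPreadditive C]

/-- Naturality along f needs checking only on the matrix entries q_l ≫ f ≫ p'_m: insert both
decompositions of the identity around f and exchange the sums. Only completeness of the two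
decompositions enters, not orthogonality. -/
theorem sum_whisker_natural {J J' : Type*} [Fintype J] [Fintype J'] {X B Y Y' : C} {F : J → C}
    {F' : J' → C} {p : ∀ l, Y ⟶ F l} {q : ∀ l, F l ⟶ Y} {p' : ∀ m, Y' ⟶ F' m}
    {q' : ∀ m, F' m ⟶ Y'} (h : ∑ l, p l ≫ q l = 𝟙 Y) (h' : ∑ m, p' m ≫ q' m = 𝟙 Y')
    (θ : ∀ l, X ⊗ F l ⟶ F l ⊗ B) (θ' : ∀ m, X ⊗ F' m ⟶ F' m ⊗ B) (f : Y ⟶ Y')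
    (hθ : ∀ l m, X ◁ (q l ≫ f ≫ p' m) ≫ θ' m = θ l ≫ (q l ≫ f ≫ p' m) ▷ B) :
    X ◁ f ≫ ∑ m, X ◁ p' m ≫ θ' m ≫ q' m ▷ B = (∑ l, X ◁ p l ≫ θ l ≫ q l ▷ B) ≫ f ▷ B := by
  calc _ = ∑ m, X ◁ ((∑ l, p l ≫ q l) ≫ f ≫ p' m) ≫ θ' m ≫ q' m ▷ B := by
        rw [h, Preadditive.comp_sum]; simp
    _ = ∑ m, ∑ l, X ◁ p l ≫ (X ◁ (q l ≫ f ≫ p' m) ≫ θ' m) ≫ q' m ▷ B := by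
        refine Finset.sum_congr rfl fun m _ => ?_
        rw [Preadditive.sum_comp, whiskerLeft_sum, Preadditive.sum_comp]; simp
    _ = ∑ l, ∑ m, X ◁ p l ≫ θ l ≫ (q l ≫ f ≫ p' m ≫ q' m) ▷ B := by
        rw [Finset.sum_comm]; simp only [hθ]; simp
    _ = ∑ l, X ◁ p l ≫ θ l ≫ (q l ≫ f ≫ (∑ m, p' m ≫ q' m)) ▷ B := by
        refine Finset.sum_congr rfl fun l _ => ?_
        simp only [Preadditive.comp_sum, sum_whiskerRight]
    _ = _ := by
        rw [h', Preadditive.sum_comp]; simp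

/-- A morphism compatible with the projections is recovered from its components. This serves both to
cut ∂ into simple pieces and to show that the assembled family has the prescribed values on simple
objects. -/
theorem sum_whisker_eq {J : Type*} [Fintype J] {X B Y : C} {F : J → C} {p : ∀ l, Y ⟶ F l}
    {q : ∀ l, F l ⟶ Y} (h : ∑ l, p l ≫ q l = 𝟙 Y) (θ : ∀ l, X ⊗ F l ⟶ F l ⊗ B)
    (t : X ⊗ Y ⟶ Y ⊗ B) (hθ : ∀ l, X ◁ p l ≫ θ l = t ≫ p l ▷ B) :
    ∑ l, X ◁ p l ≫ θ l ≫ q l ▷ B = t := by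
  calc _ = t ≫ (∑ l, p l ≫ q l) ▷ B := by
        rw [sum_whiskerRight, Preadditive.comp_sum]
        exact Finset.sum_congr rfl fun l _ => by rw [reassoc_of% hθ l, comp_whiskerRight]
    _ = t := by rw [h]; simp

theorem monoidalComp_whiskerLeft_sum {J : Type*} [Fintype J] {T T' A X Y U U' : C}
    [MonoidalCoherence T' (A ⊗ X)] [MonoidalCoherence (A ⊗ Y) U] (a : T ⟶ T') (g : U ⟶ U')
    (f : J → (X ⟶ Y)) :
    a ⊗≫ A ◁ (∑ l, f l) ⊗≫ g = ∑ l, (a ⊗≫ A ◁ f l ⊗≫ g) := by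
  simp only [monoidalComp, whiskerLeft_sum, Preadditive.sum_comp, Preadditive.comp_sum]

end Sums

/-! ### Passing between ρ and ∂, and the diagram Θ -/

section Coends

variable {C : Type u} [Category.{v} C] [MonoidalCategory C]

theorem comp_whiskerLeft_comp {T A B E Y : C} {f : T ⟶ Y ⊗ A} {g : A ⟶ B} {m : T ⟶ Y ⊗ B}
    (h : f ≫ Y ◁ g = m) (i : B ⟶ E) : m ≫ Y ◁ i = f ≫ Y ◁ (g ≫ i) := by
  rw [← h]; simp

variable [PivotalCategory C]

theorem rho_comp_eq_absorb {P : ObjectProperty C} (Z : Centralizer P) {X B : C} (Y : C) (hY : P Y)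
    (r : Z.obj X ⟶ B) : Z.rho X Y hY ≫ r = absorb (Z.part X Y hY ≫ Y ◁ r) := by
  calc _ = dual Y ◁ Z.part X Y hY ≫ (α_ _ _ _).inv ≫ (ev Y ▷ Z.obj X ≫ 𝟙_ C ◁ r) ≫
        (λ_ _).hom := by rw [Z.rho_eq]; monoidal
    _ = _ := by rw [← whisker_exchange]; unfold absorb; monoidal

/-- By a zigzag identity, `absorb` undoes the passage that produces ∂ from ρ. With
`rho_comp_eq_absorb`, statements about ∂ become statements about ρ. -/
theorem absorb_coev {X Y B : C} (d : dual Y ⊗ (X ⊗ Y) ⟶ B) :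
    absorb ((λ_ _).inv ≫ coev Y ▷ (X ⊗ Y) ≫ (α_ _ _ _).hom ≫ Y ◁ d) = d := by
  calc _ = 𝟙 _ ⊗≫ dual Y ◁ coev Y ▷ (X ⊗ Y) ⊗≫ ((dual Y ⊗ Y) ◁ d ≫ ev Y ▷ B) ⊗≫
        𝟙 _ := by unfold absorb; monoidal
    _ = 𝟙 _ ⊗≫ (dual Y ◁ coev Y ⊗≫ ev Y ▷ dual Y) ▷ (X ⊗ Y) ⊗≫ d := by
        rw [whisker_exchange]; monoidal
    _ = _ := by rw [ExactPairing.coevaluation_evaluation'']; monoidal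

/-- Only the interchange law is used: p, q, ρ_j and `ev i` act on disjoint strands and can be
reordered. In this form the left-hand side is visibly one summand of ∂ at i ⊗ Y with i evaluated. -/
theorem braidTerm_rho {P : ObjectProperty C} (Z : Centralizer P) (X : C) {i j Y : C} (hj : P j)
    (p : i ⊗ Y ⟶ j) (q : j ⟶ i ⊗ Y) :
    braidTerm X p q ≫ Y ◁ Z.rho X j hj =
      𝟙 _ ⊗≫ dual i ◁ (X ◁ p ≫ Z.part X j hj ≫ q ▷ Z.obj X) ⊗≫
        ev i ▷ (Y ⊗ Z.obj X) ⊗≫ 𝟙 _ := by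
  symm
  calc _ = 𝟙 _ ⊗≫ dual i ◁ (𝟙_ C ◁ (X ◁ p) ≫ coev j ▷ (X ⊗ j)) ⊗≫
        dual i ◁ (j ◁ Z.rho X j hj ≫ q ▷ Z.obj X) ⊗≫ ev i ▷ (Y ⊗ Z.obj X) ⊗≫ 𝟙 _ := by
        unfold Centralizer.part; monoidal
    _ = 𝟙 _ ⊗≫ dual i ◁ (coev j ▷ (X ⊗ (i ⊗ Y))) ⊗≫
        dual i ◁ ((j ⊗ dual j) ◁ (X ◁ p) ≫ q ▷ dual j ▷ (X ⊗ j)) ⊗≫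
        ((dual i ⊗ i) ◁ (Y ◁ Z.rho X j hj) ≫ ev i ▷ (Y ⊗ Z.obj X)) ⊗≫ 𝟙 _ := by
        rw [whisker_exchange, whisker_exchange]; monoidal
    _ = 𝟙 _ ⊗≫ dual i ◁ (coev j ▷ (X ⊗ (i ⊗ Y))) ⊗≫ dual i ◁ (q ▷ dual j ▷ (X ⊗ (i ⊗ Y))) ⊗≫
        ((dual i ⊗ i) ◁ ((Y ⊗ dual j) ◁ (X ◁ p)) ≫ ev i ▷ ((Y ⊗ dual j) ⊗ (X ⊗ j))) ⊗≫
        Y ◁ Z.rho X j hj ⊗≫ 𝟙 _ := by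
        rw [whisker_exchange, whisker_exchange]; monoidal
    _ = _ := by
        rw [whisker_exchange]; unfold braidTerm; monoidal

end Coends

/-- The definition provides some generator u of End(j), not necessarily the identity. Writing id = a
u and u² = b u gives u = u ∘ id = a b u = b id, so the identity generates too. -/
theorem IsSimpleObj.exists_smul_id {k : Type*} [CommRing k] {C : Type u}
    [Category.{v} C] [Preadditive C] [Linear k C] {j : C} (h : IsSimpleObj k j) (g : j ⟶ j) :
    ∃ c : k, g = c • 𝟙 j := by
  obtain ⟨e⟩ := h
  have key (f : j ⟶ j) : f = e.symm f • e 1 := by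
    rw [← map_smul, smul_eq_mul, mul_one, e.apply_symm_apply]
  obtain ⟨a, ha⟩ : ∃ a : k, 𝟙 j = a • e 1 := ⟨_, key _⟩
  obtain ⟨b, hb⟩ : ∃ b : k, e 1 ≫ e 1 = b • e 1 := ⟨_, key _⟩
  have h1 : e 1 = b • 𝟙 j := by
    calc e 1 = e 1 ≫ 𝟙 j := (Category.comp_id _).symm
      _ = b • 𝟙 j := by rw [ha, Linear.comp_smul, hb, smul_comm]
  exact ⟨e.symm g * b, by rw [mul_smul, ← h1]; exact key g⟩

/-! ### The fusion case: the coend as a direct sum, and the explicit braiding -/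

section FusionDecomposition

variable {k : Type*} [CommRing k] {G : Type w} [Group G] {C : Type u} [Category.{v} C]
  [MonoidalCategory C] [PivotalCategory C] [Preadditive C] [Linear k C] [HasFiniteBiproducts C]
  {D : PivotalGrading G C} {I : Set C}

theorem IsGRepresentative.eq_of_iso (hI : IsGRepresentative k D I) {δ : G}
    {i j : Component D I δ} (e : i.1 ≅ j.1) : i = j :=
  Subtype.ext ((hI.existsUnique i.1 (hI.simple _ i.2.1)).unique ⟨i.2.1, ⟨Iso.refl _⟩⟩
    ⟨j.2.1, ⟨e⟩⟩)

/-- Every object of `C_δ` is a finite direct sum of elements of `I_δ`. -/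
theorem IsGFusion.nonempty_partition (hF : IsGFusion k D) (hI : IsGRepresentative k D I) {δ : G}
    {T : C} (hT : D.deg δ T) : Nonempty (Partition D I δ T) := by
  obtain ⟨n, f, hf, ⟨e⟩⟩ := hF.exists_decomposition T
  choose j hj _ using fun m => hI.existsUnique (f m) (hf m)
  have a (m : Fin n) : f m ≅ j m := (hj m).2.some
  let p (m : Fin n) : T ⟶ j m := e.hom ≫ biproduct.π f m ≫ (a m).hom
  let q (m : Fin n) : j m ⟶ T := (a m).inv ≫ biproduct.ι f m ≫ e.inv
  have hqp (m : Fin n) : q m ≫ p m = 𝟙 _ := by simp [p, q]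
  -- A summand outside C_δ would have another degree, so its inclusion into T would vanish. Its
  -- identity would then be zero, which forces k, and hence T, to be zero; the empty decomposition
  -- serves in that case.
  by_cases hdeg : ∀ m, D.deg δ (j m)
  · refine ⟨⟨n, fun m => ⟨j m, (hj m).1, hdeg m⟩, p, q, hqp, fun l m hlm => ?_, ?_⟩⟩
    · simp [p, q, biproduct.ι_π_ne_assoc _ hlm]
    · calc ∑ m, p m ≫ q m = e.hom ≫ (∑ m, biproduct.π f m ≫ biproduct.ι f m) ≫ e.inv := by
            rw [Preadditive.sum_comp, Preadditive.comp_sum]; simp [p, q]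
        _ = 𝟙 T := by rw [biproduct.total]; simp
  · push Not at hdeg
    obtain ⟨m, hm⟩ := hdeg
    obtain ⟨γ, hγ⟩ := hI.homogeneous (j m) (hj m).1
    have hne : γ ≠ δ := fun h => hm (h ▸ hγ)
    have hq : q m = 0 := D.hom_eq_zero hγ hT hne _
    have hid : 𝟙 (j m) = 0 := by rw [← hqp m, hq, zero_comp]
    obtain ⟨s⟩ := hI.simple (j m) (hj m).1
    have hk : (1 : k) = 0 := s.injective (by
      rw [map_zero, ← Category.comp_id (s 1), hid, comp_zero])
    have hz : 𝟙 T = 0 := by rw [← one_smul k (𝟙 T), hk, zero_smul]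
    exact ⟨⟨0, Fin.elim0, fun l => l.elim0, fun l => l.elim0, fun l => l.elim0,
      fun l => l.elim0, by simp [hz]⟩⟩

variable [MonoidalPreadditive C]

theorem Partition.part_eq {δ : G} (Z : Centralizer (D.deg δ)) (X : C) {T : C} (hT : D.deg δ T)
    (N : Partition D I δ T) : Z.part X T hT =
      ∑ l, X ◁ N.p l ≫ Z.part X (N.idx l).1 (N.idx l).2.2 ≫ N.q l ▷ Z.obj X :=
  (sum_whisker_eq N.isDirectSum.sum _ _ fun l =>
    Z.part_natural X hT (N.idx l).2.2 (N.p l)).symm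

/-- For every W in C_δ, ∂ at W followed by W ⊗ r is natural in W, so a decomposition of W into
elements of I_δ expresses it through its values there. -/
theorem part_ext_of_simple (hF : IsGFusion k D) (hI : IsGRepresentative k D I)
    {δ : G} (Z : Centralizer (D.deg δ)) {X B : C} {r r' : Z.obj X ⟶ B}
    (h : ∀ i : Component D I δ, Z.part X i.1 i.2.2 ≫ i.1 ◁ r =
      Z.part X i.1 i.2.2 ≫ i.1 ◁ r') : r = r' := by
  refine Z.part_ext fun W hW => ?_
  obtain ⟨N⟩ := hF.nonempty_partition hI hW
  have e (s : Z.obj X ⟶ B) := sum_whisker_eq N.isDirectSum.sum _ _ fun l =>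
    Z.part_comp_natural X hW (N.idx l).2.2 (N.p l) s
  rw [← e r, ← e r']
  exact Finset.sum_congr rfl fun l _ => by rw [h (N.idx l)]

theorem rho_ext (hF : IsGFusion k D) (hI : IsGRepresentative k D I)
    {δ : G} (Z : Centralizer (D.deg δ)) {X B : C} {r r' : Z.obj X ⟶ B}
    (h : ∀ i : Component D I δ, Z.rho X i.1 i.2.2 ≫ r = Z.rho X i.1 i.2.2 ≫ r') :
    r = r' := by
  refine part_ext_of_simple hF hI Z fun i => ?_
  simp only [Centralizer.part, Category.assoc, ← MonoidalCategory.whiskerLeft_comp, h i]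

variable [MonoidalLinear k C]

/-- No condition on θ is needed: distinct elements of I_δ are not isomorphic, so g = 0 unless i = j,
and then g is a multiple of the identity. -/
theorem whisker_comm_of_simple (hF : IsGFusion k D) (hI : IsGRepresentative k D I) {δ : G}
    {X B : C} (θ : ∀ i : Component D I δ, X ⊗ i.1 ⟶ i.1 ⊗ B) (i j : Component D I δ)
    (g : i.1 ⟶ j.1) : X ◁ g ≫ θ j = θ i ≫ g ▷ B := by
  by_cases h : i = j
  · subst h
    obtain ⟨c, rfl⟩ := (hI.simple _ i.2.1).exists_smul_id g
    simp
  · rw [hF.hom_eq_zero _ _ (hI.simple _ i.2.1) (hI.simple _ j.2.1)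
      (fun ⟨e⟩ => h (hI.eq_of_iso e)) g]
    simp

/-- The family θ is extended to all of C_δ by choosing a decomposition of each object. The extension
is natural, and independent of the choice on I_δ, because θ commutes with every morphism between
elements of I_δ; the coend then supplies r. -/
theorem exists_part_eq (hF : IsGFusion k D) (hI : IsGRepresentative k D I) {δ : G}
    (Z : Centralizer (D.deg δ)) {X B : C} (θ : ∀ i : Component D I δ, X ⊗ i.1 ⟶ i.1 ⊗ B) :
    ∃ r : Z.obj X ⟶ B, ∀ i : Component D I δ, Z.part X i.1 i.2.2 ≫ i.1 ◁ r = θ i := by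
  let N (Y : C) (hY : D.deg δ Y) : Partition D I δ Y := (hF.nonempty_partition hI hY).some
  obtain ⟨r, hr, -⟩ := Z.existsUnique X B
    (fun Y hY => ∑ l, X ◁ (N Y hY).p l ≫ θ ((N Y hY).idx l) ≫ (N Y hY).q l ▷ B)
    (fun Y Y' hY hY' f => sum_whisker_natural (N Y hY).isDirectSum.sum (N Y' hY').isDirectSum.sum
      _ _ f fun _ _ => whisker_comm_of_simple hF hI θ _ _ _)
  exact ⟨r, fun i => (hr i.1 i.2.2).trans <|
    sum_whisker_eq (N i.1 i.2.2).isDirectSum.sum _ (θ i) fun _ =>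
      whisker_comm_of_simple hF hI θ _ _ _⟩

theorem exists_rho_comp_eq (hF : IsGFusion k D) (hI : IsGRepresentative k D I) {δ : G}
    (Z : Centralizer (D.deg δ)) {X B : C} (d : ∀ i : Component D I δ, dual i.1 ⊗ (X ⊗ i.1) ⟶ B) :
    ∃ r : Z.obj X ⟶ B, ∀ i : Component D I δ, Z.rho X i.1 i.2.2 ≫ r = d i := by
  obtain ⟨r, hr⟩ := exists_part_eq hF hI Z (fun i : Component D I δ =>
    (λ_ _).inv ≫ coev i.1 ▷ (X ⊗ i.1) ≫ (α_ _ _ _).hom ≫ i.1 ◁ d i)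
  exact ⟨r, fun i => by rw [rho_comp_eq_absorb, hr, absorb_coev]⟩

/-- Each projection is the morphism out of the coend with Kronecker delta components. The sum of the
idempotents is the identity because both agree after every ρ_i. -/
theorem exists_isDirectSum_rho (hF : IsGFusion k D) (hI : IsGRepresentative k D I)
    {δ : G} (Z : Centralizer (D.deg δ)) [Fintype (Component D I δ)] (X : C) :
    ∃ π : ∀ i : Component D I δ, Z.obj X ⟶ dual i.1 ⊗ (X ⊗ i.1),
      IsDirectSum (fun i : Component D I δ => Z.rho X i.1 i.2.2) π := by
  classical
  choose π hπ using fun i : Component D I δ => exists_rho_comp_eq hF hI Z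
    -- The component at j = i is an identity; `eqToHom` only transports it along the equality of
    -- indices.
    (fun j : Component D I δ => if h : j = i then
      eqToHom (congrArg (fun l : Component D I δ => dual l.1 ⊗ (X ⊗ l.1)) h) else 0)
  have hne (i j : Component D I δ) (h : i ≠ j) : Z.rho X i.1 i.2.2 ≫ π j = 0 := by
    rw [hπ j i, dif_neg h]
  have heq (i : Component D I δ) : Z.rho X i.1 i.2.2 ≫ π i = 𝟙 _ := by
    rw [hπ i i, dif_pos rfl, eqToHom_refl]
  refine ⟨π, heq, hne, rho_ext hF hI Z fun i => ?_⟩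
  rw [Preadditive.comp_sum, Finset.sum_eq_single i
    (fun j _ hj => by rw [← Category.assoc, hne i j hj.symm, zero_comp])
    (fun h => absurd (Finset.mem_univ i) h), ← Category.assoc, heq, Category.id_comp,
    Category.comp_id]

variable (Z : ∀ α : G, Centralizer (D.deg α))

/-- The identity of Z_α(X) is cut into its summands, and then ∂^γ at each i ⊗ Y is cut along the
given partition. -/
theorem mix_eq_sum_braidTerm {α β γ : G} (h : α * β = γ) (X Y : C) (hY : D.deg β Y)
    [Fintype (Component D I α)]
    {π : ∀ i : Component D I α, (Z α).obj X ⟶ dual i.1 ⊗ (X ⊗ i.1)}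
    (hπ : IsDirectSum (fun i : Component D I α => (Z α).rho X i.1 i.2.2) π)
    (P : ∀ i : Component D I α, Partition D I γ (i.1 ⊗ Y)) :
    mix Z h X Y hY = ∑ i : Component D I α, ∑ l : Fin (P i).n,
      π i ▷ Y ≫ braidTerm X ((P i).p l) ((P i).q l) ≫
        Y ◁ (Z γ).rho X ((P i).idx l).1 ((P i).idx l).2.2 := by
  calc _ = (∑ i, π i ≫ (Z α).rho X i.1 i.2.2) ▷ Y ≫ mix Z h X Y hY := by
        rw [hπ.sum, id_whiskerRight, Category.id_comp]
    _ = ∑ i, π i ▷ Y ≫ (Z α).rho X i.1 i.2.2 ▷ Y ≫ mix Z h X Y hY := by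
        rw [sum_whiskerRight, Preadditive.sum_comp]
        simp only [comp_whiskerRight, Category.assoc]
    _ = _ := Finset.sum_congr rfl fun i _ => by
        rw [rho_whiskerRight_mix, (P i).part_eq (Z γ) X, monoidalComp_whiskerLeft_sum]
        simp only [braidTerm_rho, ← Preadditive.comp_sum]

end FusionDecomposition

end

end GCat

/-! ### The theorem -/

theorem theorem9p4 {k : Type*} [CommRing k] {G : Type w} [Group G] {C : Type u} [Category.{v} C]
    [MonoidalCategory C] [PivotalCategory C] [Preadditive C] [Linear k C] [MonoidalPreadditive C]
    [MonoidalLinear k C] [HasFiniteBiproducts C] (D : PivotalGrading G C) (hD : NonSingular D)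
    (S : Splittings D) (L : Crossing S hD.pure) (Z : ∀ α : G, Centralizer (D.deg α))
    (α β : G) (X Y : C) (hY : D.deg β Y) :
    ∃ _ : IsIso (omega Z hD L (rfl : α * β = α * β) X),
      tau hD L (free Z α X) Y hY =
        (Z β).part ((Z α).obj X) Y hY ≫
          Y ◁ (Z2 Z (rfl : α * β = α * β) X ≫ (inv (omega Z hD L rfl X)).hom) ∧
      ∀ (hF : IsGFusion k D) (I : Set C) (hI : IsGRepresentative k D I),
        letI := fun δ : G => componentFintype hF hI δ
        (∀ δ : G, ∃ π : ∀ i : Component D I δ, (Z δ).obj X ⟶ dual i.1 ⊗ (X ⊗ i.1),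
          IsDirectSum (fun i : Component D I δ => (Z δ).rho X i.1 i.2.2) π) ∧
        (∀ i : Component D I α, Nonempty (Partition D I (α * β) (i.1 ⊗ Y))) ∧
        ∀ (π : ∀ i : Component D I α, (Z α).obj X ⟶ dual i.1 ⊗ (X ⊗ i.1)),
          IsDirectSum (fun i : Component D I α => (Z α).rho X i.1 i.2.2) π →
          ∀ (P : ∀ i : Component D I α, Partition D I (α * β) (i.1 ⊗ Y)),
            tau hD L (free Z α X) Y hY =
              (∑ i : Component D I α, ∑ l : Fin (P i).n,
                π i ▷ Y ≫ braidTerm X ((P i).p l) ((P i).q l) ≫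
                  Y ◁ (Z (α * β)).rho X ((P i).idx l).1 ((P i).idx l).2.2) ≫
              Y ◁ (inv (omega Z hD L rfl X)).hom := by
  have hω := isIso_omega Z hD L (rfl : α * β = α * β) X
  refine ⟨hω, ?_, fun hF I hI => ?_⟩
  · exact (tau_free Z hD L rfl X Y hY).trans (comp_whiskerLeft_comp (part_Z2 Z rfl X Y hY) _)
  · let := fun δ : G => componentFintype hF hI δ
    refine ⟨fun δ => exists_isDirectSum_rho hF hI (Z δ) X,
      fun i => hF.nonempty_partition hI (D.tensor_mem i.2.2 hY), fun π hπ P => ?_⟩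
    rw [tau_free Z hD L rfl X Y hY, mix_eq_sum_braidTerm Z rfl X Y hY hπ P]
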